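/- **Setting.** Let $0<q<1$, $a>0$, $0<\alpha<1$, $A_{q,a}=\{aq^n:n\ge 0\}$, $A^*_{q,a}=A_{q,a}\cup\{0\}$. Write $(z;q)_\infty=\prod_{k\ge0}(1-zq^k)$, $(z;q)_\nu=(z;q)_\infty/(zq^\nu;q)_\infty$, $\Gamma_q(x)=\frac{(q;q)_\infty}{(q^x;q)_\infty}(1-q)^{1-x}$, $\int_0^b f\,d_qt=(1-q)b\sum_{n\ge0}q^nf(bq^n)$, $\int_b^c=\int_0^c-\int_0^b$, $D_qf(x)=\frac{f(x)-f(qx)}{x-qx}$ and $$I^{\nu}_{q,0^+}f(x)=\frac{x^{\nu-1}}{\Gamma_q(\nu)}\int_0^x(qt/x;q)_{\nu-1}f(t)\,d_qt,\qquad I^{\nu}_{q,a^-}f(x)=\frac1{\Gamma_q(\nu)}\int_{qx}^a t^{\nu-1}(qx/t;q)_{\nu-1}f(t)\,d_qt,$$ ${}^cD^\alpha_{q,0^+}f=I^{1-\alpha}_{q,0^+}D_qf$ and $D^\alpha_{q,a^-}f=-\frac1qD_{q^{-1}}I^{1-\alpha}_{q,a^-}f$, where $D_{q^{-1}}g(0)$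 means $\lim_n\frac{g(aq^n)-g(0)}{aq^n}$. A function $f$ on $A^*_{q,a}$ is *$q$-regular at zero* if $f(xq^n)\to f(0)$ for all $x\in A^*_{q,a}$; $L^2_q(A^*_{q,a})$ is the space of $f$ with $\|f\|_2=(\int_0^a|f|^2d_qt)^{1/2}<\infty$. Let $p,r,w_\alpha$ be real functions on $A^*_{q,a}$ with $p\ne0$ and $w_\alpha>0$ on $A^*_{q,a}$, $\inf_{A_{q,a}}p>0$ and $r,w_\alpha\in L^2_q(A^*_{q,a})$; let $c_1,c_2,d_1,d_2\in\mathbb R$ with $c_1^2+c_2^2\neq0$, $d_1^2+d_2^2\ne0$. For $\lambda\in\mathbb K$ ($\mathbb K=\mathbb R$ or $\mathbb C$) consider, for $y:A^*_{q,a}\to\mathbb K$, the problem (P) $$D^\alpha_{q,a^-}\big(p\,{}^cD^\alpha_{q,0^+}y\big)(x)+r(x)y(x)-\lambda w_\alpha(x)y(x)=0,\quad x\in A^*_{q,a},$$ $$c_1y(0)+c_2u(0)=0,\qquad d_1y(a)+d_2u(a/q)=0,\qquad u:=I^{1-\alpha}_{q,a^-}\big(p\,{}^cD^\alpha_{q,0^+}y\big).$$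 Here $u(a/q)$ enters also in the equation at $x=a$, and it is $0$ when its defining $q$-integral (from $a$ to $a$) is taken literally. Call $y$ an *extended solution* if it is $q$-regular at zero, the equation, with its first term written as $-\frac1qD_{q^{-1}}u$, holds on $A_{q,a}$, and the boundary conditions hold, for some choice of the value $u(a/q)\in\mathbb K$. Every $q$-regular solution of (P) is an extended solution. $\lambda$ is an *eigenvalue* if it has an extended solution $y\not\equiv0$ on $A^*_{q,a}$, and it is *simple* if, moreover, all extended solutions are constant multiples of one of them. Put $\psi(x)=I^\alpha_{q,0^+}\Big[\frac{a^{\alpha-1}(q\,\cdot/a;q)_{\alpha-1}}{\Gamma_q(\alpha)p(\cdot)}\Big](x)$, $\Delta=c_1d_2-c_2d_1+c_1d_1\psi(a)$, and, when $\Delta\ne0$, $$A=\sup_{x\in A^*_{q,a}}\Big|\tfrac{c_2}{\Delta}\big[d_2+d_1(\psi(a)-\psi(x))\big]\Big|,\quad B=\sup_{x\in A^*_{q,a}}\Big|\tfrac{d_1}{\Delta}\big[c_1\psi(x)-c_2\big]\Big|,\quad m_p=\inf_{x\in A_{q,a}}|p(x)|.$$ **Theorem 3.8.** Assume $\Delta\neq0$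 and that $\lambda$ satisfies $$\|r-\lambda w_\alpha\|_2<\frac{m_p}{(1+B)a^{2\alpha-\frac12}c_\alpha+A\sqrt a\,m_p},\qquad c_\alpha=\frac{(1-q)^{\alpha-\frac12}}{(q;q)_\infty\sqrt{1-q^{2\alpha-1}}},\qquad\text{if }\tfrac12<\alpha<1,$$ or $$\|r-\lambda w_\alpha\|_2<\frac{m_p}{(1+B)a^{2\alpha-\frac12}\gamma_\alpha+A\sqrt a\,m_p},\qquad \gamma_\alpha=\frac{\Gamma_q(\alpha+\frac12)}{(q^\alpha;q)_\infty\Gamma_q(2\alpha+\frac12)}\sqrt{\frac{1-q}{1-q^{1-2\alpha}}},\qquad\text{if }\tfrac14<\alpha<\tfrac12.$$ Then there is exactly one $q$-regular at zero function $y_\lambda$ on $A^*_{q,a}$ that solves (P) (with $u(a/q)$ taken literally), and $y_\lambda$ is also the only extended solution. If $\lambda$ is moreover an eigenvalue, then it is simple. -/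

import Mathlib

open Filter Topology Set

noncomputable section

namespace QFSL

/-- `A_{q,a} = {a qⁿ : n ∈ ℕ₀}`. -/
def grid (q a : ℝ) : Set ℝ := {x | ∃ n : ℕ, x = a * q ^ n}

/-- `A*_{q,a} = A_{q,a} ∪ {0}`. -/
def gridZero (q a : ℝ) : Set ℝ := insert 0 (grid q a)

/-- The infinite `q`-shifted factorial `(z; q)_∞ = ∏_{k ≥ 0} (1 - z q^k)`. -/
def qPochInf (q z : ℝ) : ℝ := ∏' k : ℕ, (1 - z * q ^ k)

/-- `(z; q)_ν = (z; q)_∞ / (z q^ν; q)_∞` for a real exponent `ν`. -/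
def qPoch (q z ν : ℝ) : ℝ := qPochInf q z / qPochInf q (z * q ^ ν)

/-- `Γ_q(x) = (q; q)_∞ / (q^x; q)_∞ * (1 - q)^(1 - x)`. -/
def qGamma (q x : ℝ) : ℝ :=
  qPochInf q q / qPochInf q (q ^ x) * (1 - q) ^ (1 - x)

section Operators

variable {E : Type*} [NormedAddCommGroup E] [NormedSpace ℝ E]

/-- Jackson's integral `∫_0^b f d_q t = (1 - q) b ∑_{n ≥ 0} qⁿ f(b qⁿ)`, the series being summed
in the ordinary sense (limit of its partial sums, not necessarily absolutely convergent). -/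
def qIntZero (q b : ℝ) (f : ℝ → E) : E :=
  ((1 - q) * b) • ∑'[SummationFilter.conditional ℕ] n : ℕ, (q ^ n) • f (b * q ^ n)

/-- `∫_b^c f d_q t = ∫_0^c f d_q t - ∫_0^b f d_q t`. -/
def qInt (q b c : ℝ) (f : ℝ → E) : E := qIntZero q c f - qIntZero q b f

/-- Jackson's `q`-difference operator `D_q f(x) = (f(x) - f(qx)) / (x - qx)` at points `x ≠ 0`
(the base may also be `q⁻¹`). -/
def qDeriv (q : ℝ) (f : ℝ → E) (x : ℝ) : E := (x - q * x)⁻¹ • (f x - f (q * x))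

/-- The left-sided Riemann–Liouville operator
`I^ν_{q,0+} f(x) = x^(ν-1) / Γ_q(ν) * ∫_0^x (qt/x; q)_{ν-1} f(t) d_q t`. -/
def leftInt (q ν : ℝ) (f : ℝ → E) (x : ℝ) : E :=
  (x ^ (ν - 1) / qGamma q ν) • qInt q 0 x (fun t => qPoch q (q * t / x) (ν - 1) • f t)

/-- The right-sided Riemann–Liouville operator
`I^ν_{q,a-} f(x) = 1 / Γ_q(ν) * ∫_{qx}^a t^(ν-1) (qx/t; q)_{ν-1} f(t) d_q t`. -/
def rightInt (q a ν : ℝ) (f : ℝ → E) (x : ℝ) : E :=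
  (1 / qGamma q ν) •
    qInt q (q * x) a (fun t => (t ^ (ν - 1) * qPoch q (q * x / t) (ν - 1)) • f t)

/-- The left-sided Caputo derivative `I^{1-α}_{q,0+} D_q f` of order `α ∈ (0, 1)`. -/
def leftCaputo (q α : ℝ) (f : ℝ → E) : ℝ → E := leftInt q (1 - α) (qDeriv q f)

/-- The right-sided Riemann–Liouville derivative `(-1/q) D_{q⁻¹} I^{1-α}_{q,a-} f` of order
`α ∈ (0, 1)`, at points `x ≠ 0`. -/
def rightDeriv (q a α : ℝ) (f : ℝ → E) (x : ℝ) : E :=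
  (-1 / q) • qDeriv q⁻¹ (rightInt q a (1 - α) f) x

/-- The quasi-derivative `I^{1-α}_{q,a-} (p · ᶜD^α_{q,0+} y)`. -/
def quasiDeriv (q a α : ℝ) (p : ℝ → ℝ) (y : ℝ → E) : ℝ → E :=
  rightInt q a (1 - α) (fun t => p t • leftCaputo q α y t)

/-- `f` is `q`-regular at zero on `A*_{q,a}`, i.e. belongs to `C(A*_{q,a})`. -/
def IsQRegular (q a : ℝ) (f : ℝ → E) : Prop :=
  ∀ x ∈ gridZero q a, Tendsto (fun n : ℕ => f (x * q ^ n)) atTop (𝓝 (f 0))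

/-- `f ∈ L²_q(A*_{q,a})`, i.e. `∫_0^a |f|² d_q x < ∞`. -/
def MemL2 (q a : ℝ) (f : ℝ → E) : Prop :=
  Summable fun n : ℕ => q ^ n * ‖f (a * q ^ n)‖ ^ 2

/-- `‖f‖_2 = (∫_0^a |f|² d_q x)^(1/2)`. -/
def normL2 (q a : ℝ) (f : ℝ → E) : ℝ := Real.sqrt (qInt q 0 a (fun t => ‖f t‖ ^ 2))

/-- The sup norm over `A*_{q,a}`. -/
def supNorm (q a : ℝ) (f : ℝ → E) : ℝ := ⨆ x : gridZero q a, ‖f x‖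

end Operators

/-- `ψ_{α,a}(x) = I^α_{q,0+} [a^(α-1) (q·/a; q)_{α-1} / (Γ_q(α) p(·))] (x)`. -/
def psi (q a α : ℝ) (p : ℝ → ℝ) : ℝ → ℝ :=
  leftInt q α (fun x => a ^ (α - 1) * qPoch q (q * x / a) (α - 1) / (qGamma q α * p x))

/-- `Δ = c₁ d₂ - c₂ d₁ + c₁ d₁ ψ_{α,a}(a)`. -/
def Delta (q a α : ℝ) (p : ℝ → ℝ) (c₁ c₂ d₁ d₂ : ℝ) : ℝ :=
  c₁ * d₂ - c₂ * d₁ + c₁ * d₁ * psi q a α p a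

/-- `A(x) = (c₂ / Δ) [d₂ + d₁ (ψ(a) - ψ(x))]`. -/
def coefA (q a α : ℝ) (p : ℝ → ℝ) (c₁ c₂ d₁ d₂ : ℝ) (x : ℝ) : ℝ :=
  c₂ / Delta q a α p c₁ c₂ d₁ d₂ * (d₂ + d₁ * (psi q a α p a - psi q a α p x))

/-- `B(x) = (d₁ / Δ) [c₁ ψ(x) - c₂]`. -/
def coefB (q a α : ℝ) (p : ℝ → ℝ) (c₁ c₂ d₁ d₂ : ℝ) (x : ℝ) : ℝ :=
  d₁ / Delta q a α p c₁ c₂ d₁ d₂ * (c₁ * psi q a α p x - c₂)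

/-- `m_p = inf_{x ∈ A_{q,a}} |p(x)|`. -/
def infAbs (q a : ℝ) (p : ℝ → ℝ) : ℝ := ⨅ x : grid q a, |p x|

/-- `c_α = (1 - q)^(α - 1/2) / ((q; q)_∞ √(1 - q^(2α - 1)))`. -/
def cConst (q α : ℝ) : ℝ :=
  (1 - q) ^ (α - 1 / 2) / (qPochInf q q * Real.sqrt (1 - q ^ (2 * α - 1)))

/-- `γ_α = Γ_q(α + 1/2) / ((q^α; q)_∞ Γ_q(2α + 1/2)) √((1 - q) / (1 - q^(1 - 2α)))`. -/
def gammaConst (q α : ℝ) : ℝ :=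
  qGamma q (α + 1 / 2) / (qPochInf q (q ^ α) * qGamma q (2 * α + 1 / 2)) *
    Real.sqrt ((1 - q) / (1 - q ^ (1 - 2 * α)))

/-- The bound `m_p / ((1 + B) a^(2α - 1/2) κ + A √a m_p)` with `A = ‖A(·)‖`, `B = ‖B(·)‖`. -/
def bound (q a α : ℝ) (p : ℝ → ℝ) (c₁ c₂ d₁ d₂ κ : ℝ) : ℝ :=
  infAbs q a p /
    ((1 + supNorm q a (coefB q a α p c₁ c₂ d₁ d₂)) * a ^ (2 * α - 1 / 2) * κ +
      supNorm q a (coefA q a α p c₁ c₂ d₁ d₂) * Real.sqrt a * infAbs q a p)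

section Problem

variable {𝕜 : Type*} [RCLike 𝕜]

/-- `y` is a `q`-regular at zero solution of
`D^α_{q,a-} (p · ᶜD^α_{q,0+} y) + r y - λ w y = 0` on `A*_{q,a}` with the two boundary conditions.
At `x = 0` the operator `D_{q⁻¹}` is the limit of the difference quotients along the grid. -/
structure IsSolution (q a α : ℝ) (p r w : ℝ → ℝ) (c₁ c₂ d₁ d₂ : ℝ) (lam : 𝕜)
    (y : ℝ → 𝕜) : Prop where
  regular : IsQRegular q a y
  equation : ∀ x ∈ grid q a,
    rightDeriv q a α (fun t => p t • leftCaputo q α y t) x + r x • y x - lam * (w x • y x) = 0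
  equation_zero : ∃ l : 𝕜,
    Tendsto (fun n : ℕ => (a * q ^ n)⁻¹ • (quasiDeriv q a α p y (a * q ^ n) -
      quasiDeriv q a α p y 0)) atTop (𝓝 l) ∧
    (-1 / q) • l + r 0 • y 0 - lam * (w 0 • y 0) = 0
  bc_zero : c₁ • y 0 + c₂ • quasiDeriv q a α p y 0 = 0
  bc_right : d₁ • y a + d₂ • quasiDeriv q a α p y (a / q) = 0

/-- A weaker notion of solution. Here `u` is the quasi-derivative of `y` on `A*_{q,a}`, while its
value at the outer point `a / q` is free. (The `q`-integral defining the quasi-derivative at `a / q`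
runs from `a` to `a`; reading it literally means the choice `u (a / q) = 0`.) The value `u (a / q)`
enters through the equation at `x = a` and through the second boundary condition. Nothing is
required of the equation at the point `x = 0`, which is negligible for the `q`-integral. -/
structure IsExtSolution (q a α : ℝ) (p r w : ℝ → ℝ) (c₁ c₂ d₁ d₂ : ℝ) (lam : 𝕜)
    (y u : ℝ → 𝕜) : Prop where
  regular : IsQRegular q a y
  quasi : ∀ x ∈ gridZero q a, u x = quasiDeriv q a α p y x
  equation : ∀ x ∈ grid q a,
    (-1 / q) • qDeriv q⁻¹ u x + r x • y x - lam * (w x • y x) = 0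
  bc_zero : c₁ • y 0 + c₂ • u 0 = 0
  bc_right : d₁ • y a + d₂ • u (a / q) = 0

theorem IsSolution.isExtSolution {q a α : ℝ} {p r w : ℝ → ℝ} {c₁ c₂ d₁ d₂ : ℝ} {lam : 𝕜}
    {y : ℝ → 𝕜} (h : IsSolution q a α p r w c₁ c₂ d₁ d₂ lam y) :
    IsExtSolution q a α p r w c₁ c₂ d₁ d₂ lam y (quasiDeriv q a α p y) :=
  ⟨h.regular, fun _ _ => rfl, h.equation, h.bc_zero, h.bc_right⟩

/-- `λ` is an eigenvalue: there is a solution that does not vanish identically on `A*_{q,a}`. -/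
def IsEigenvalue (q a α : ℝ) (p r w : ℝ → ℝ) (c₁ c₂ d₁ d₂ : ℝ) (lam : 𝕜) : Prop :=
  ∃ y u : ℝ → 𝕜, IsExtSolution q a α p r w c₁ c₂ d₁ d₂ lam y u ∧ ∃ x ∈ gridZero q a, y x ≠ 0

/-- `λ` is a simple eigenvalue: it has an eigenfunction, and every solution is a constant multiple
of that eigenfunction on `A*_{q,a}`. -/
def IsSimpleEigenvalue (q a α : ℝ) (p r w : ℝ → ℝ) (c₁ c₂ d₁ d₂ : ℝ) (lam : 𝕜) : Prop :=
  ∃ y u : ℝ → 𝕜, IsExtSolution q a α p r w c₁ c₂ d₁ d₂ lam y u ∧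
    (∃ x ∈ gridZero q a, y x ≠ 0) ∧
    ∀ z v : ℝ → 𝕜, IsExtSolution q a α p r w c₁ c₂ d₁ d₂ lam z v →
      ∃ c : 𝕜, EqOn z (fun x => c * y x) (gridZero q a)

end Problem

end QFSL

end

open Filter Topology Set

noncomputable section

namespace QFSL

/-! ### The infinite `q`-shifted factorial and the `q`-binomial theorem -/

section Pochhammer

variable {q : ℝ}

/-! Below the bound the only extended solution is zero; uniqueness and simplicity follow, because
zero solves the literal problem. Let `y` be an extended solution, U = u(a/q) and g = (r - λw)y. The
equation telescopes to u(aqⁿ) = U - ∑_{k≤n} (1-q)aqᵏ g(aqᵏ). On the grid, fractional integrals are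
convolutions with the coefficients (q^ν;q)_k/(q;q)_k, and `one_sub_X_mul_qBinom` supplies the
convolution inverse. It yields p·ᶜD^α y = U·kernel - I^α_{a-} g (`eq_of_rightInt_eq`), and also
I^α_{0+} ᶜD^α y = y - y(0) (`leftInt_leftCaputo`). Dividing by p and integrating, y = y(0) + ψU - T
with T = I^α_{0+}(p⁻¹ I^α_{a-} g). The boundary conditions are a linear system for y(0) and U with
determinant Δ. Solving it gives y(x) = A(x)∫g + B(x)T(a) - T(x) (`IsExtSolution.green`). By
Cauchy–Schwarz |∫g| ≤ √a ‖g‖₂, and the bounds for the two fractional integrals give |T| ≤ a^(2α-1/2)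
κ ‖g‖₂ / m_p, with κ = c_α or γ_α. Since ‖g‖₂ ≤ ‖r - λw‖₂ sup|y|, the hypothesis on λ says sup|y| ≤
θ sup|y| with θ < 1, so y = 0. -/

theorem summable_mul_geometric (hq₀ : 0 < q) (hq₁ : q < 1) (z : ℝ) :
    Summable fun k : ℕ => -(z * q ^ k) :=
  ((summable_geometric_of_lt_one hq₀.le hq₁).mul_left z).neg

theorem multipliable_qPochInf (hq₀ : 0 < q) (hq₁ : q < 1) (z : ℝ) :
    Multipliable fun k : ℕ => 1 - z * q ^ k := by
  simpa only [sub_eq_add_neg] using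
    Real.multipliable_one_add_of_summable (summable_mul_geometric hq₀ hq₁ z)

theorem mul_pow_lt_one (hq₀ : 0 < q) (hq₁ : q < 1) {z : ℝ} (hz : z < 1) (k : ℕ) :
    z * q ^ k < 1 := by
  have h0 : 0 < q ^ k := pow_pos hq₀ k
  have h1 : q ^ k ≤ 1 := pow_le_one₀ hq₀.le hq₁.le
  nlinarith

theorem qPochInf_ne_zero (hq₀ : 0 < q) (hq₁ : q < 1) {z : ℝ} (hz : z < 1) :
    qPochInf q z ≠ 0 := by
  have := tprod_one_add_ne_zero_of_summable (R := ℝ) (f := fun k : ℕ => -(z * q ^ k))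
    (fun k => by have := mul_pow_lt_one hq₀ hq₁ hz k; linarith)
    (summable_mul_geometric hq₀ hq₁ z).norm
  simpa only [qPochInf, sub_eq_add_neg] using this

theorem tendsto_qPochInf (hq₀ : 0 < q) (hq₁ : q < 1) (z : ℝ) :
    Tendsto (fun n => ∏ k ∈ Finset.range n, (1 - z * q ^ k)) atTop (𝓝 (qPochInf q z)) :=
  (multipliable_qPochInf hq₀ hq₁ z).hasProd.tendsto_prod_nat

theorem qPochInf_pos (hq₀ : 0 < q) (hq₁ : q < 1) {z : ℝ} (hz : z < 1) : 0 < qPochInf q z := by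
  refine lt_of_le_of_ne ?_ (qPochInf_ne_zero hq₀ hq₁ hz).symm
  refine ge_of_tendsto' (tendsto_qPochInf hq₀ hq₁ z) fun n => Finset.prod_nonneg fun k _ => ?_
  have := mul_pow_lt_one hq₀ hq₁ hz k
  linarith

theorem qPochInf_step (hq₀ : 0 < q) (hq₁ : q < 1) (z : ℝ) :
    qPochInf q z = (1 - z) * qPochInf q (z * q) := by
  have h1 := (tendsto_qPochInf hq₀ hq₁ z).comp (tendsto_add_atTop_nat 1)
  refine tendsto_nhds_unique h1 (((tendsto_qPochInf hq₀ hq₁ (z * q)).const_mul (1 - z)).congr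
    fun n => ?_)
  simp only [Function.comp, Finset.prod_range_succ', pow_zero, mul_one, pow_succ', mul_assoc]
  ring

theorem qPochInf_le (hq₀ : 0 < q) (hq₁ : q < 1) {z : ℝ} (hz₀ : 0 ≤ z) (hz : z < 1) :
    qPochInf q z ≤ 1 - z := by
  refine le_of_tendsto (tendsto_qPochInf hq₀ hq₁ z) ?_
  filter_upwards [eventually_ge_atTop 1] with n hn
  obtain ⟨m, rfl⟩ := Nat.exists_eq_add_of_le' hn
  rw [Finset.prod_range_succ']
  have h : ∏ k ∈ Finset.range m, (1 - z * q ^ (k + 1)) ≤ 1 := by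
    refine Finset.prod_le_one (fun k _ => ?_) (fun k _ => ?_)
    · have := mul_pow_lt_one hq₀ hq₁ hz (k + 1)
      linarith
    · have : 0 ≤ z * q ^ (k + 1) := by positivity
      linarith
  simpa using mul_le_of_le_one_left (by linarith : (0 : ℝ) ≤ 1 - z) h

theorem qPochInf_eq_zero {z : ℝ} (k : ℕ) (hz : z * q ^ k = 1) : qPochInf q z = 0 :=
  tprod_of_exists_eq_zero ⟨k, by rw [hz, sub_self]⟩

theorem qPochInf_zero : qPochInf q 0 = 1 := by simp [qPochInf]

/-- The coefficient `(A; q)_k / (q; q)_k` of the `q`-binomial series. -/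
def qBinomCoeff (q A : ℝ) (k : ℕ) : ℝ :=
  ∏ i ∈ Finset.range k, (1 - A * q ^ i) / (1 - q ^ (i + 1))

@[simp]
theorem qBinomCoeff_zero (A : ℝ) : qBinomCoeff q A 0 = 1 := by simp [qBinomCoeff]

theorem one_sub_pow_succ_pos (hq₀ : 0 < q) (hq₁ : q < 1) (k : ℕ) : 0 < 1 - q ^ (k + 1) :=
  sub_pos.2 (pow_lt_one₀ hq₀.le hq₁ k.succ_ne_zero)

theorem qBinomCoeff_succ (A : ℝ) (k : ℕ) :
    qBinomCoeff q A (k + 1) = qBinomCoeff q A k * ((1 - A * q ^ k) / (1 - q ^ (k + 1))) := by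
  rw [qBinomCoeff, Finset.prod_range_succ, qBinomCoeff]

theorem qBinomCoeff_succ_mul (hq₀ : 0 < q) (hq₁ : q < 1) (A : ℝ) (k : ℕ) :
    qBinomCoeff q A (k + 1) * (1 - q ^ (k + 1)) = qBinomCoeff q A k * (1 - A * q ^ k) := by
  have := (one_sub_pow_succ_pos hq₀ hq₁ k).ne'
  rw [qBinomCoeff_succ]
  field_simp

theorem qBinomCoeff_pos (hq₀ : 0 < q) (hq₁ : q < 1) {A : ℝ} (hA : A < 1) (k : ℕ) :
    0 < qBinomCoeff q A k := by
  refine Finset.prod_pos fun i _ => div_pos ?_ (one_sub_pow_succ_pos hq₀ hq₁ i)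
  have := mul_pow_lt_one hq₀ hq₁ hA i
  linarith

/-- For q ≤ A each factor (1 - Aqᵏ)/(1 - qᵏ⁺¹) is at most 1. With A = q^ν, 0 < ν < 1, this gives
both the bounded variation and the bound by 1 used throughout. -/
theorem qBinomCoeff_antitone (hq₀ : 0 < q) (hq₁ : q < 1) {A : ℝ} (hA : A < 1) (hqA : q ≤ A) :
    Antitone (qBinomCoeff q A) := by
  refine antitone_nat_of_succ_le fun k => ?_
  rw [qBinomCoeff_succ]
  refine mul_le_of_le_one_right (qBinomCoeff_pos hq₀ hq₁ hA k).le ?_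
  rw [div_le_one (one_sub_pow_succ_pos hq₀ hq₁ k), pow_succ']
  have := mul_le_mul_of_nonneg_right hqA (pow_pos hq₀ k).le
  linarith

theorem qBinomCoeff_le_one (hq₀ : 0 < q) (hq₁ : q < 1) {A : ℝ} (hA : A < 1) (hqA : q ≤ A)
    (k : ℕ) : qBinomCoeff q A k ≤ 1 := by
  simpa using qBinomCoeff_antitone hq₀ hq₁ hA hqA k.zero_le

theorem summable_qBinomCoeff_mul_pow (hq₀ : 0 < q) (hq₁ : q < 1) {A : ℝ} (hA : A < 1)
    (hqA : q ≤ A) {z : ℝ} (hz₀ : 0 ≤ z) (hz₁ : z < 1) :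
    Summable fun k => qBinomCoeff q A k * z ^ k :=
  (summable_geometric_of_lt_one hz₀ hz₁).of_nonneg_of_le
    (fun k => mul_nonneg (qBinomCoeff_pos hq₀ hq₁ hA k).le (pow_nonneg hz₀ k))
    fun k => mul_le_of_le_one_left (pow_nonneg hz₀ k) (qBinomCoeff_le_one hq₀ hq₁ hA hqA k)

/-- The coefficient recursion, read as a q-difference equation (1 - z)F(z) = (1 - Az)F(qz) for the
sum F of the series. -/
theorem tsum_qBinomCoeff_step (hq₀ : 0 < q) (hq₁ : q < 1) {A : ℝ} (hA : A < 1)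
    (hqA : q ≤ A) {z : ℝ} (hz₀ : 0 ≤ z) (hz₁ : z < 1) :
    (1 - z) * ∑' k, qBinomCoeff q A k * z ^ k =
      (1 - A * z) * ∑' k, qBinomCoeff q A k * (z * q) ^ k := by
  have hzq : z * q < 1 := by nlinarith
  have h1 := summable_qBinomCoeff_mul_pow hq₀ hq₁ hA hqA hz₀ hz₁
  have h2 := summable_qBinomCoeff_mul_pow hq₀ hq₁ hA hqA (mul_nonneg hz₀ hq₀.le) hzq
  have e1 : ∑' k, qBinomCoeff q A k * z ^ k - ∑' k, qBinomCoeff q A k * (z * q) ^ k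
      = z * (∑' k, qBinomCoeff q A k * z ^ k) - A * z * ∑' k, qBinomCoeff q A k * (z * q) ^ k := by
    rw [← h1.tsum_sub h2, (h1.sub h2).tsum_eq_zero_add, ← tsum_mul_left, ← tsum_mul_left,
      ← (h1.mul_left z).tsum_sub (h2.mul_left (A * z))]
    simp only [pow_zero, sub_self, zero_add]
    refine tsum_congr fun k => ?_
    have := qBinomCoeff_succ_mul hq₀ hq₁ A k
    rw [mul_pow, mul_pow]
    linear_combination z ^ (k + 1) * this
  linarith

/-- The `q`-binomial theorem `∑ (A; q)_k / (q; q)_k z^k = (A z; q)_∞ / (z; q)_∞`. -/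
theorem tsum_qBinomCoeff (hq₀ : 0 < q) (hq₁ : q < 1) {A : ℝ} (hA : A < 1)
    (hqA : q ≤ A) {z : ℝ} (hz₀ : 0 ≤ z) (hz₁ : z < 1) :
    ∑' k, qBinomCoeff q A k * z ^ k = qPochInf q (A * z) / qPochInf q z := by
  set F : ℝ → ℝ := fun z => ∑' k, qBinomCoeff q A k * z ^ k with hF
  have hz : ∀ n : ℕ, 0 ≤ z * q ^ n ∧ z * q ^ n < 1 := fun n =>
    ⟨by positivity, mul_pow_lt_one hq₀ hq₁ hz₁ n⟩
  -- Iterating the q-difference equation pushes the argument to zqⁿ → 0, where F tends to 1 by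
  -- dominated convergence.
  have hiter : ∀ n : ℕ, (∏ k ∈ Finset.range n, (1 - z * q ^ k)) * F z =
      (∏ k ∈ Finset.range n, (1 - A * z * q ^ k)) * F (z * q ^ n) := by
    intro n
    induction n with
    | zero => simp
    | succ n ih =>
      have := tsum_qBinomCoeff_step hq₀ hq₁ hA hqA (hz n).1 (hz n).2
      rw [Finset.prod_range_succ, Finset.prod_range_succ, mul_right_comm, ih, pow_succ, ← mul_assoc z]
      simp only [hF]
      linear_combination (∏ k ∈ Finset.range n, (1 - A * z * q ^ k)) * this
  have hlim : Tendsto (fun n : ℕ => F (z * q ^ n)) atTop (𝓝 1) := by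
    have h0 : Tendsto (fun n : ℕ => z * q ^ n) atTop (𝓝 0) := by
      simpa using (tendsto_pow_atTop_nhds_zero_of_lt_one hq₀.le hq₁).const_mul z
    have : (1 : ℝ) = ∑' k, qBinomCoeff q A k * (0 : ℝ) ^ k := by
      rw [tsum_eq_single 0 fun k hk => by simp [hk]]; simp
    rw [this]
    refine tendsto_tsum_of_dominated_convergence
      (summable_qBinomCoeff_mul_pow hq₀ hq₁ hA hqA hz₀ hz₁)
      (fun k => (h0.pow k).const_mul _) (Eventually.of_forall fun n k => ?_)
    have := (qBinomCoeff_pos hq₀ hq₁ hA k).le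
    rw [Real.norm_of_nonneg (mul_nonneg this (pow_nonneg (hz n).1 k))]
    refine mul_le_mul_of_nonneg_left (pow_le_pow_left₀ (hz n).1 ?_ k) this
    exact mul_le_of_le_one_right hz₀ (pow_le_one₀ hq₀.le hq₁.le)
  have h1 := (tendsto_qPochInf hq₀ hq₁ z).mul_const (F z)
  have h2 := (tendsto_qPochInf hq₀ hq₁ (A * z)).mul hlim
  rw [eq_div_iff (qPochInf_ne_zero hq₀ hq₁ hz₁), mul_comm]
  simpa using tendsto_nhds_unique h1 (h2.congr fun n => (hiter n).symm)

open PowerSeries in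
/-- The generating functions of `(A; q)_k / (q; q)_k` and of `(q / A; q)_k / (q; q)_k * A^k` have
the product `1 / (1 - X)`. -/
theorem one_sub_X_mul_qBinom (hq₀ : 0 < q) (hq₁ : q < 1) {A : ℝ} (hA : A ≠ 0) :
    (1 - X) * PowerSeries.mk (qBinomCoeff q A) *
      PowerSeries.mk (fun k => qBinomCoeff q (q / A) k * A ^ k) = 1 := by
  set Φ : PowerSeries ℝ := PowerSeries.mk (qBinomCoeff q A) with hΦ
  set Ψ : PowerSeries ℝ := PowerSeries.mk (fun k => qBinomCoeff q (q / A) k * A ^ k) with hΨ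
  have e1 : (1 - X) * Φ = (1 - C A * X) * rescale q Φ := by
    ext n
    cases n with
    | zero =>
      simp only [sub_mul, one_mul, mul_assoc, map_sub, coeff_zero_X_mul, coeff_C_mul,
        coeff_rescale]
      simp
    | succ n =>
      simp only [sub_mul, one_mul, mul_assoc, map_sub, coeff_succ_X_mul, coeff_C_mul,
        coeff_rescale, hΦ, coeff_mk]
      linear_combination qBinomCoeff_succ_mul hq₀ hq₁ A n
  have e2 : (1 - C A * X) * Ψ = (1 - C q * X) * rescale q Ψ := by
    ext n
    cases n with
    | zero =>
      simp only [sub_mul, one_mul, mul_assoc, map_sub, coeff_zero_X_mul, coeff_C_mul,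
        coeff_rescale]
      simp
    | succ n =>
      simp only [sub_mul, one_mul, mul_assoc, map_sub, coeff_succ_X_mul, coeff_C_mul,
        coeff_rescale, hΨ, coeff_mk]
      have := qBinomCoeff_succ_mul hq₀ hq₁ (q / A) n
      have h3 : q / A * A = q := div_mul_cancel₀ q hA
      linear_combination A ^ (n + 1) * this - (qBinomCoeff q (q / A) n) * A ^ n * q ^ n * h3
  set P := (1 - X) * Φ * Ψ with hP
  -- The q-difference equations of the two factors make P invariant under X ↦ qX. As qⁿ ≠ 1 for n ≥
  -- 1, only the constant coefficient survives. The argument is formal and needs no convergence.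
  have hPr : P = rescale q P := by
    have : rescale q P = (1 - C q * X) * rescale q Φ * rescale q Ψ := by
      simp [hP, rescale_X]
    rw [this, hP, e1]
    linear_combination (rescale q Φ) * e2
  ext n
  cases n with
  | zero => simp [hP, hΦ, hΨ]
  | succ n =>
    have h := congrArg (coeff (n + 1)) hPr
    rw [coeff_rescale] at h
    have hne := (one_sub_pow_succ_pos hq₀ hq₁ n).ne'
    have : (1 - q ^ (n + 1)) * coeff (n + 1) P = 0 := by linarith
    simpa [coeff_one] using (mul_eq_zero.1 this).resolve_left hne

/-- On the grid the fractional kernel is, up to a constant absorbed by Γ_q(ν), a q-binomial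
coefficient. This turns fractional integrals into convolutions. -/
theorem qPoch_pow_succ (hq₀ : 0 < q) (hq₁ : q < 1) {ν : ℝ} (hν : 0 < ν) (k : ℕ) :
    qPoch q (q ^ (k + 1)) (ν - 1) = qPoch q q (ν - 1) * qBinomCoeff q (q ^ ν) k := by
  have hA : q ^ ν < 1 := Real.rpow_lt_one hq₀.le hq₁ hν
  have hs : ∀ k : ℕ, q ^ (k + 1) * q ^ (ν - 1) = q ^ ν * q ^ k := fun k => by
    rw [Real.rpow_sub_one hq₀.ne', pow_succ]
    field_simp
  induction k with
  | zero => simp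
  | succ k ih =>
    have h1 := qPochInf_step hq₀ hq₁ (q ^ (k + 1))
    have h2 := qPochInf_step hq₀ hq₁ (q ^ ν * q ^ k)
    have h3 := mul_pow_lt_one hq₀ hq₁ hA k
    have h4 := mul_pow_lt_one hq₀ hq₁ hA (k + 1)
    have h5 := qPochInf_ne_zero hq₀ hq₁ h4
    have h6 := (one_sub_pow_succ_pos hq₀ hq₁ k).ne'
    rw [mul_assoc, ← pow_succ] at h2
    rw [← pow_succ] at h1
    rw [qBinomCoeff_succ, ← mul_assoc, ← ih, qPoch, qPoch, hs, hs, h1, h2]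
    have h7 : 1 - q ^ ν * q ^ k ≠ 0 := by linarith
    field_simp

theorem qGamma_eq (hq₀ : 0 < q) (ν : ℝ) :
    qGamma q ν = qPoch q q (ν - 1) * (1 - q) ^ (1 - ν) := by
  rw [qGamma, qPoch, Real.rpow_sub_one hq₀.ne', mul_div_cancel₀ _ hq₀.ne']

theorem qPoch_self_pos (hq₀ : 0 < q) (hq₁ : q < 1) {ν : ℝ} (hν : 0 < ν) :
    0 < qPoch q q (ν - 1) := by
  rw [qPoch, Real.rpow_sub_one hq₀.ne', mul_div_cancel₀ _ hq₀.ne']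
  exact div_pos (qPochInf_pos hq₀ hq₁ hq₁)
    (qPochInf_pos hq₀ hq₁ (Real.rpow_lt_one hq₀.le hq₁ hν))

end Pochhammer

/-! ### Conditionally convergent series and convolutions -/

section Series

variable {E : Type*} [NormedAddCommGroup E]

theorem hasSum_conditional_iff {f : ℕ → E} {s : E} :
    HasSum f s (SummationFilter.conditional ℕ) ↔
      Tendsto (fun n => ∑ k ∈ Finset.range n, f k) atTop (𝓝 s) := by
  rw [HasSum, SummationFilter.conditional_filter_eq_map_range, tendsto_map'_iff]
  rfl

theorem tsum_conditional_eq {f : ℕ → E} (hf : Summable f) :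
    ∑'[SummationFilter.conditional ℕ] n, f n = ∑' n, f n :=
  (hasSum_conditional_iff.2 hf.hasSum.tendsto_sum_nat).tsum_eq

theorem exists_norm_le_of_tendsto {Y : ℕ → E} {l : E} (hY : Tendsto Y atTop (𝓝 l)) :
    ∃ M, ∀ n, ‖Y n‖ ≤ M := by
  obtain ⟨M, hM⟩ := hY.norm.bddAbove_range
  exact ⟨M, fun n => hM ⟨n, rfl⟩⟩

/-- The backward difference `c k - c (k - 1)`, with `c (-1) = 0`. -/
def backDiff (c : ℕ → ℝ) : ℕ → ℝ
  | 0 => c 0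
  | k + 1 => c (k + 1) - c k

theorem coeff_one_sub_X_mul (c : ℕ → ℝ) (k : ℕ) :
    PowerSeries.coeff k ((1 - PowerSeries.X) * PowerSeries.mk c) = backDiff c k := by
  cases k with
  | zero => simp [sub_mul, backDiff]
  | succ k =>
    simp only [sub_mul, one_mul, map_sub, PowerSeries.coeff_succ_X_mul, PowerSeries.coeff_mk,
      backDiff]

theorem summable_backDiff {c : ℕ → ℝ} (hc : Antitone c) (hc₀ : ∀ k, 0 ≤ c k) :
    Summable (backDiff c) := by
  rw [← summable_nat_add_iff 1, ← summable_neg_iff]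
  refine summable_of_sum_range_le (c := c 0) (fun k => ?_) (fun n => ?_)
  · simpa [backDiff] using hc k.le_succ
  · have : ∑ k ∈ Finset.range n, -backDiff c (k + 1) = c 0 - c n := by
      simpa [backDiff] using Finset.sum_range_sub' c n
    linarith [hc₀ n]

variable [NormedSpace ℝ E]

/-- Abel summation: differences move from `Y`, which will only be assumed convergent, to `c`, which
will have bounded variation. A conditionally convergent series thereby becomes an absolutely
convergent one. -/
theorem sum_range_smul_sub (c : ℕ → ℝ) (Y : ℕ → E) (n : ℕ) :
    ∑ k ∈ Finset.range (n + 1), c k • (Y k - Y (k + 1)) =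
      ∑ k ∈ Finset.range (n + 1), backDiff c k • Y k - c n • Y (n + 1) := by
  induction n with
  | zero => simp [backDiff, smul_sub]
  | succ n ih =>
    rw [Finset.sum_range_succ, ih, Finset.sum_range_succ _ (n + 1), backDiff]
    module

variable [CompleteSpace E]

theorem summable_smul_of_bounded {b : ℕ → ℝ} (hb : Summable b) {Y : ℕ → E} {M : ℝ}
    (hY : ∀ n, ‖Y n‖ ≤ M) : Summable fun k => b k • Y k := by
  refine Summable.of_norm_bounded (hb.norm.mul_right M) fun k => ?_
  rw [norm_smul]
  exact mul_le_mul_of_nonneg_left (hY k) (norm_nonneg _)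

/-- Summation by parts for a series `∑ c k (Y k - Y (k + 1))`. -/
theorem tsum_conditional_smul_sub {c : ℕ → ℝ} (hc : Antitone c) (hc₀ : ∀ k, 0 ≤ c k) {Y : ℕ → E}
    (hY : Tendsto Y atTop (𝓝 0)) :
    ∑'[SummationFilter.conditional ℕ] k, c k • (Y k - Y (k + 1)) = ∑' k, backDiff c k • Y k := by
  obtain ⟨M, hM⟩ := exists_norm_le_of_tendsto hY
  refine (hasSum_conditional_iff.2 ?_).tsum_eq
  rw [← tendsto_add_atTop_iff_nat 1]
  have h1 := (summable_smul_of_bounded (summable_backDiff hc hc₀) hM).hasSum.tendsto_sum_nat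
  have h2 : Tendsto (fun n => c n • Y (n + 1)) atTop (𝓝 0) := by
    refine squeeze_zero_norm (a := fun n => c 0 * ‖Y (n + 1)‖) (fun n => ?_) ?_
    · rw [norm_smul, Real.norm_of_nonneg (hc₀ n)]
      exact mul_le_mul_of_nonneg_right (hc n.zero_le) (norm_nonneg _)
    · simpa using ((tendsto_add_atTop_iff_nat 1).2 hY.norm).const_mul (c 0)
  simpa [sum_range_smul_sub] using ((tendsto_add_atTop_iff_nat 1).2 h1).sub h2

/-- The double family is absolutely summable, so it can be regrouped by j + k. Composing two such
operators thus amounts to convolving their coefficients. -/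
theorem tsum_smul_tsum_smul_add {a b : ℕ → ℝ} (ha : Summable a) (hb : Summable b) {Y : ℕ → E}
    {M : ℝ} (hY : ∀ n, ‖Y n‖ ≤ M) :
    ∑' j, a j • ∑' k, b k • Y (j + k) =
      ∑' m, (∑ x ∈ Finset.HasAntidiagonal.antidiagonal m, a x.1 * b x.2) • Y m := by
  have hab : Summable fun x : ℕ × ℕ => (a x.1 * b x.2) • Y (x.1 + x.2) := by
    refine Summable.of_norm_bounded
      ((ha.norm.mul_of_nonneg hb.norm (fun _ => norm_nonneg _) fun _ => norm_nonneg _).mul_right M)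
      fun x => ?_
    rw [norm_smul, norm_mul]
    exact mul_le_mul_of_nonneg_left (hY _) (by positivity)
  have h1 : ∑' j, a j • ∑' k, b k • Y (j + k) =
      ∑' x : ℕ × ℕ, (a x.1 * b x.2) • Y (x.1 + x.2) := by
    rw [hab.tsum_prod]
    refine tsum_congr fun j => ?_
    rw [← (summable_smul_of_bounded hb fun k => hY (j + k)).tsum_const_smul]
    simp only [mul_smul]
  rw [h1, ← Finset.HasAntidiagonal.sigmaAntidiagonalEquivProd.tsum_eq, Summable.tsum_sigma']
  · refine tsum_congr fun m => ?_
    rw [tsum_fintype, Finset.sum_smul, ← Finset.sum_coe_sort (Finset.HasAntidiagonal.antidiagonal m)]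
    refine Finset.sum_congr rfl fun x _ => ?_
    have := Finset.HasAntidiagonal.mem_antidiagonal.1 x.2
    simp [this]
  · exact fun m => (hasSum_fintype _).summable
  · exact (Finset.HasAntidiagonal.sigmaAntidiagonalEquivProd.summable_iff).2 hab

end Series

/-! ### Fractional `q`-integrals at grid points -/

section Grid

variable {E : Type*} [NormedAddCommGroup E] [NormedSpace ℝ E] {q a : ℝ}

theorem leftInt_grid (hq₀ : 0 < q) (hq₁ : q < 1) {x : ℝ} (hx : 0 < x) {ν : ℝ} (hν : 0 < ν)
    (f : ℝ → E) :
    leftInt q ν f x = (x ^ ν * (1 - q) ^ ν) •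
      ∑'[SummationFilter.conditional ℕ] k : ℕ,
        (q ^ k * qBinomCoeff q (q ^ ν) k) • f (x * q ^ k) := by
  have hβ := qPoch_self_pos hq₀ hq₁ hν
  have hq : 0 < 1 - q := sub_pos.2 hq₁
  have h1 : ∀ k : ℕ, q ^ k • qPoch q (q * (x * q ^ k) / x) (ν - 1) • f (x * q ^ k) =
      qPoch q q (ν - 1) • (q ^ k * qBinomCoeff q (q ^ ν) k) • f (x * q ^ k) := fun k => by
    have : q * (x * q ^ k) / x = q ^ (k + 1) := by
      rw [pow_succ']
      field_simp
    rw [this, qPoch_pow_succ hq₀ hq₁ hν, smul_smul, smul_smul]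
    ring_nf
  rw [leftInt, qInt, qIntZero, qIntZero, mul_zero, zero_smul, sub_zero]
  simp only [h1]
  rw [tsum_const_smul'', smul_smul, smul_smul, qGamma_eq hq₀]
  congr 1
  rw [Real.rpow_sub_one hx.ne', Real.rpow_sub hq, Real.rpow_one]
  have := (Real.rpow_pos_of_pos hq ν).ne'
  field_simp

theorem leftInt_at_zero (ν : ℝ) (f : ℝ → E) : leftInt q ν f 0 = 0 := by
  simp [leftInt, qInt]

theorem qPoch_div_eq_zero (hq₀ : 0 < q) {x : ℝ} (hx : x ≠ 0) (k : ℕ) (ν : ℝ) :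
    qPoch q (q * x / (q * x * q ^ k)) ν = 0 := by
  rw [qPoch, qPochInf_eq_zero k, zero_div]
  have := hq₀.ne'
  field_simp

/-- The kernel contains a vanishing factor at every t = qx·qᵏ. The integral over [0, qx] is
therefore zero and the one over [0, a] breaks off after k = n, whatever `f` is. -/
theorem rightInt_grid (hq₀ : 0 < q) (hq₁ : q < 1) (ha : 0 < a) {ν : ℝ} (hν : 0 < ν)
    (f : ℝ → E) (n : ℕ) :
    rightInt q a ν f (a * q ^ n) = (1 - q) ^ ν •
      ∑ k ∈ Finset.range (n + 1),
        (qBinomCoeff q (q ^ ν) (n - k) * (a * q ^ k) ^ ν) • f (a * q ^ k) := by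
  have hβ := qPoch_self_pos hq₀ hq₁ hν
  have hq : 0 < 1 - q := sub_pos.2 hq₁
  have hx : ∀ k : ℕ, 0 < a * q ^ k := fun k => by positivity
  have h1 : qIntZero q (q * (a * q ^ n)) (fun t =>
      (t ^ (ν - 1) * qPoch q (q * (a * q ^ n) / t) (ν - 1)) • f t) = 0 := by
    rw [qIntZero]
    simp only [qPoch_div_eq_zero hq₀ (hx n).ne', mul_zero, zero_smul, smul_zero, tsum_zero]
  rw [rightInt, qInt, h1, sub_zero, qIntZero, tsum_conditional_eq, tsum_eq_sum
    (s := Finset.range (n + 1))]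
  · rw [smul_smul, Finset.smul_sum, Finset.smul_sum]
    refine Finset.sum_congr rfl fun k hk => ?_
    obtain ⟨m, rfl⟩ := Nat.exists_eq_add_of_le (Nat.lt_succ_iff.1 (Finset.mem_range.1 hk))
    have : q * (a * q ^ (k + m)) / (a * q ^ k) = q ^ (m + 1) := by
      rw [pow_add, pow_succ']
      field_simp
    rw [this, qPoch_pow_succ hq₀ hq₁ hν, smul_smul, smul_smul, smul_smul, qGamma_eq hq₀,
      Nat.add_sub_cancel_left, Real.rpow_sub_one (hx k).ne', Real.rpow_sub hq, Real.rpow_one]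
    congr 1
    have := (Real.rpow_pos_of_pos hq ν).ne'
    have := (hx k).ne'
    field_simp
  all_goals
    have h0 : ∀ k ∉ Finset.range (n + 1), q ^ k • (((a * q ^ k) ^ (ν - 1) *
        qPoch q (q * (a * q ^ n) / (a * q ^ k)) (ν - 1)) • f (a * q ^ k)) = 0 := by
      intro k hk
      obtain ⟨m, rfl⟩ := Nat.exists_eq_add_of_le (not_lt.1 (mt Finset.mem_range.2 hk))
      have : a * q ^ (n + 1 + m) = q * (a * q ^ n) * q ^ m := by ring
      rw [this, qPoch_div_eq_zero hq₀ (hx n).ne', mul_zero, zero_smul, smul_zero]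
  · exact h0
  · exact summable_of_ne_finset_zero h0

/-- At x = 0 the kernel is 1 and the sum does not break off, so convergence becomes an issue at this
point only. -/
theorem rightInt_at_zero (hq₀ : 0 < q) (ha : 0 < a) (ν : ℝ) (f : ℝ → E) :
    rightInt q a ν f 0 = ((1 - q) / qGamma q ν) •
      ∑'[SummationFilter.conditional ℕ] k : ℕ, (a * q ^ k) ^ ν • f (a * q ^ k) := by
  have hx : ∀ k : ℕ, 0 < a * q ^ k := fun k => by positivity
  have h1 : ∀ k : ℕ, q ^ k • (((a * q ^ k) ^ (ν - 1) *
      qPoch q (q * 0 / (a * q ^ k)) (ν - 1)) • f (a * q ^ k)) =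
      a⁻¹ • (a * q ^ k) ^ ν • f (a * q ^ k) := fun k => by
    have h2 : qPoch q (q * 0 / (a * q ^ k)) (ν - 1) = 1 := by
      simp [qPoch, qPochInf_zero]
    rw [h2, Real.rpow_sub_one (hx k).ne', smul_smul, smul_smul]
    congr 1
    field_simp
  rw [rightInt, qInt, qIntZero, qIntZero]
  simp only [h1]
  rw [mul_zero, mul_zero, zero_smul, sub_zero, tsum_const_smul'', smul_smul, smul_smul]
  congr 1
  field_simp

end Grid

/-! ### Inversion formulas for the fractional operators -/

section Inversion

variable {q a α : ℝ}

theorem rpow_mem (hq₀ : 0 < q) (hq₁ : q < 1) {ν : ℝ} (hν₀ : 0 < ν) (hν₁ : ν < 1) :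
    q ^ ν < 1 ∧ q ≤ q ^ ν := by
  refine ⟨Real.rpow_lt_one hq₀.le hq₁ hν₀, ?_⟩
  simpa using Real.rpow_le_rpow_of_exponent_ge hq₀ hq₁.le hν₁.le

theorem div_rpow_one_sub (hq₀ : 0 < q) (α : ℝ) : q / q ^ (1 - α) = q ^ α := by
  nth_rw 1 [← Real.rpow_one q]
  rw [← Real.rpow_sub hq₀, sub_sub_cancel]

/-- The coefficient `(q^α; q)_k / (q; q)_k * q^((1-α) k)`. -/
def dualCoeff (q α : ℝ) (k : ℕ) : ℝ := qBinomCoeff q (q ^ α) k * (q ^ (1 - α)) ^ k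

theorem summable_dualCoeff (hq₀ : 0 < q) (hq₁ : q < 1) (hα₀ : 0 < α) (hα₁ : α < 1) :
    Summable (dualCoeff q α) :=
  summable_qBinomCoeff_mul_pow hq₀ hq₁ (rpow_mem hq₀ hq₁ hα₀ hα₁).1 (rpow_mem hq₀ hq₁ hα₀ hα₁).2
    (Real.rpow_nonneg hq₀.le _) (Real.rpow_lt_one hq₀.le hq₁ (sub_pos.2 hα₁))

/-- The q-binomial theorem at z = q^(1-α), where Az = q. The value is the constant in Γ_q(1-α), with
which it cancels in the integral at x = 0. -/
theorem tsum_dualCoeff (hq₀ : 0 < q) (hq₁ : q < 1) (hα₀ : 0 < α) (hα₁ : α < 1) :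
    ∑' k, dualCoeff q α k = qPoch q q (1 - α - 1) := by
  have h := tsum_qBinomCoeff hq₀ hq₁ (rpow_mem hq₀ hq₁ hα₀ hα₁).1 (rpow_mem hq₀ hq₁ hα₀ hα₁).2
    (Real.rpow_nonneg hq₀.le _) (Real.rpow_lt_one hq₀.le hq₁ (sub_pos.2 hα₁))
  rw [← Real.rpow_add hq₀, add_sub_cancel, Real.rpow_one] at h
  rw [qPoch, Real.rpow_sub_one hq₀.ne', mul_div_cancel₀ _ hq₀.ne', ← h]
  rfl

theorem one_sub_X_mul_mk_dualCoeff (hq₀ : 0 < q) (hq₁ : q < 1) (α : ℝ) :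
    (1 - PowerSeries.X) * PowerSeries.mk (qBinomCoeff q (q ^ (1 - α))) *
      PowerSeries.mk (dualCoeff q α) = 1 := by
  have h := one_sub_X_mul_qBinom hq₀ hq₁ (Real.rpow_pos_of_pos hq₀ (1 - α)).ne'
  rwa [div_rpow_one_sub hq₀] at h

theorem sum_antidiagonal_dualCoeff (hq₀ : 0 < q) (hq₁ : q < 1) (α : ℝ) (m : ℕ) :
    ∑ x ∈ Finset.HasAntidiagonal.antidiagonal m,
      dualCoeff q α x.1 * backDiff (qBinomCoeff q (q ^ (1 - α))) x.2 = if m = 0 then 1 else 0 := by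
  have h := congrArg (PowerSeries.coeff m) (one_sub_X_mul_mk_dualCoeff hq₀ hq₁ α)
  rw [mul_comm, PowerSeries.coeff_mul, PowerSeries.coeff_one] at h
  simpa only [PowerSeries.coeff_mk, coeff_one_sub_X_mul] using h

theorem qDeriv_smul {E : Type*} [NormedAddCommGroup E] [NormedSpace ℝ E] (x : ℝ) (f : ℝ → E) :
    qDeriv q f x = (x * (1 - q))⁻¹ • (f x - f (x * q)) := by
  rw [qDeriv, mul_comm q x, mul_sub, mul_one]

/-! ### Left-sided operators: the Caputo derivative and its inversion -/

section Left

variable {E : Type*} [NormedAddCommGroup E] [NormedSpace ℝ E] [CompleteSpace E]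

/-- Summation by parts. The constant y(0) is subtracted so that the sequence tends to 0 and no
boundary term remains. -/
theorem leftCaputo_grid (hq₀ : 0 < q) (hq₁ : q < 1) (hα₀ : 0 < α) (hα₁ : α < 1) {x : ℝ}
    (hx : 0 < x) {y : ℝ → E} (hy : Tendsto (fun n : ℕ => y (x * q ^ n)) atTop (𝓝 (y 0))) :
    leftCaputo q α y x = (x ^ (-α) * (1 - q) ^ (-α)) •
      ∑' k, backDiff (qBinomCoeff q (q ^ (1 - α))) k • (y (x * q ^ k) - y 0) := by
  have hβ : 0 < 1 - α := sub_pos.2 hα₁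
  have hq : 0 < 1 - q := sub_pos.2 hq₁
  obtain ⟨h1, h2⟩ := rpow_mem hq₀ hq₁ hβ (by linarith : 1 - α < 1)
  have hY : Tendsto (fun n : ℕ => y (x * q ^ n) - y 0) atTop (𝓝 0) := by
    simpa using hy.sub_const (y 0)
  rw [leftCaputo, leftInt_grid hq₀ hq₁ hx hβ, ← tsum_conditional_smul_sub
    (qBinomCoeff_antitone hq₀ hq₁ h1 h2) (fun k => (qBinomCoeff_pos hq₀ hq₁ h1 k).le) hY]
  have h3 : ∀ k : ℕ, (q ^ k * qBinomCoeff q (q ^ (1 - α)) k) • qDeriv q y (x * q ^ k) =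
      (x * (1 - q))⁻¹ • qBinomCoeff q (q ^ (1 - α)) k •
        (y (x * q ^ k) - y 0 - (y (x * q ^ (k + 1)) - y 0)) := fun k => by
    rw [qDeriv_smul, smul_smul, smul_smul, sub_sub_sub_cancel_right, pow_succ, ← mul_assoc x]
    congr 1
    have := (pow_pos hq₀ k).ne'
    field_simp
  simp only [h3]
  rw [tsum_const_smul'', smul_smul]
  congr 1
  rw [sub_eq_neg_add, Real.rpow_add hx, Real.rpow_add hq, Real.rpow_one, Real.rpow_one]
  field_simp

/-- The fundamental theorem `I^α_{q,0+} ᶜD^α_{q,0+} y = y - y(0)` at grid points. -/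
theorem leftInt_leftCaputo (hq₀ : 0 < q) (hq₁ : q < 1) (hα₀ : 0 < α) (hα₁ : α < 1) {x : ℝ}
    (hx : 0 < x) {y : ℝ → E} (hy : Tendsto (fun n : ℕ => y (x * q ^ n)) atTop (𝓝 (y 0))) :
    leftInt q α (leftCaputo q α y) x = y x - y 0 := by
  have hβ : 0 < 1 - α := sub_pos.2 hα₁
  have hq : 0 < 1 - q := sub_pos.2 hq₁
  obtain ⟨h1, h2⟩ := rpow_mem hq₀ hq₁ hβ (by linarith : 1 - α < 1)
  have hb := summable_backDiff (qBinomCoeff_antitone hq₀ hq₁ h1 h2)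
    fun k => (qBinomCoeff_pos hq₀ hq₁ h1 k).le
  have he := summable_dualCoeff hq₀ hq₁ hα₀ hα₁
  have hY : Tendsto (fun n : ℕ => y (x * q ^ n) - y 0) atTop (𝓝 0) := by
    simpa using hy.sub_const (y 0)
  obtain ⟨M, hM⟩ := exists_norm_le_of_tendsto hY
  -- The factor (xqʲ)^(-α) combines with qʲ into q^((1-α)j), which turns the coefficients of I^α
  -- into `dualCoeff`.
  have h3 : ∀ j : ℕ, (q ^ j * qBinomCoeff q (q ^ α) j) • leftCaputo q α y (x * q ^ j) =
      (x ^ (-α) * (1 - q) ^ (-α)) • dualCoeff q α j •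
        ∑' k, backDiff (qBinomCoeff q (q ^ (1 - α))) k • (y (x * q ^ (j + k)) - y 0) := fun j => by
    have hxj : 0 < x * q ^ j := by positivity
    have hyj : Tendsto (fun n : ℕ => y (x * q ^ j * q ^ n)) atTop (𝓝 (y 0)) := by
      simpa only [mul_assoc, ← pow_add, add_comm j] using (tendsto_add_atTop_iff_nat j).2 hy
    rw [leftCaputo_grid hq₀ hq₁ hα₀ hα₁ hxj hyj, smul_smul, smul_smul]
    simp only [mul_assoc x, ← pow_add]
    congr 1
    rw [Real.mul_rpow hx.le (pow_nonneg hq₀.le j), dualCoeff, sub_eq_add_neg 1 α,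
      Real.rpow_add hq₀, Real.rpow_one, mul_pow, Real.rpow_pow_comm hq₀.le]
    ring
  rw [leftInt_grid hq₀ hq₁ hx hα₀]
  simp only [h3]
  have hM' : ∀ j : ℕ, ‖∑' k, backDiff (qBinomCoeff q (q ^ (1 - α))) k •
      (y (x * q ^ (j + k)) - y 0)‖ ≤ (∑' k, ‖backDiff (qBinomCoeff q (q ^ (1 - α))) k‖) * M := by
    intro j
    refine tsum_of_norm_bounded (hb.norm.hasSum.mul_right M) fun k => ?_
    rw [norm_smul]
    exact mul_le_mul_of_nonneg_left (hM _) (norm_nonneg _)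
  -- Grouped by j + k, the coefficients are the convolution of `dualCoeff` with the backward
  -- differences, the unit sequence. Only m = 0 contributes.
  rw [tsum_const_smul'', tsum_conditional_eq (summable_smul_of_bounded he hM'),
    tsum_smul_tsum_smul_add (Y := fun n : ℕ => y (x * q ^ n) - y 0) he hb hM, smul_smul,
    tsum_eq_single 0]
  · rw [sum_antidiagonal_dualCoeff hq₀ hq₁]
    have : x ^ α * (1 - q) ^ α * (x ^ (-α) * (1 - q) ^ (-α)) = 1 := by
      rw [Real.rpow_neg hx.le, Real.rpow_neg hq.le]
      have := (Real.rpow_pos_of_pos hq α).ne'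
      have := (Real.rpow_pos_of_pos hx α).ne'
      field_simp
    simp [this]
  · intro m hm
    rw [sum_antidiagonal_dualCoeff hq₀ hq₁, if_neg hm, zero_smul]

end Left

/-! ### Right-sided operators: inversion on the grid and the value at zero -/

section Right

variable {𝕜 : Type*} [RCLike 𝕜]

/-- Inversion of a convolution equation: if the right-sided integral of order `1 - α` of `f` is
`U - ∫_{qx}^a g`, then `f` is the corresponding convolution with `dualCoeff`. -/
theorem rpow_smul_eq_of_rightInt_eq (hq₀ : 0 < q) (hq₁ : q < 1) (ha : 0 < a)
    (hα₁ : α < 1) {f g : ℝ → 𝕜} {U : 𝕜}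
    (h : ∀ n : ℕ, rightInt q a (1 - α) f (a * q ^ n) =
      U - ∑ k ∈ Finset.range (n + 1), ((1 - q) * (a * q ^ k)) • g (a * q ^ k)) (n : ℕ) :
    ((1 - q) ^ (1 - α) * (a * q ^ n) ^ (1 - α)) • f (a * q ^ n) =
      dualCoeff q α n • U - ∑ k ∈ Finset.range (n + 1),
        dualCoeff q α (n - k) • ((1 - q) * (a * q ^ k)) • g (a * q ^ k) := by
  have hβ : 0 < 1 - α := sub_pos.2 hα₁
  set Cs : PowerSeries 𝕜 :=
    PowerSeries.mk fun k => ((qBinomCoeff q (q ^ (1 - α)) k : ℝ) : 𝕜) with hCs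
  set Es : PowerSeries 𝕜 := PowerSeries.mk fun k => ((dualCoeff q α k : ℝ) : 𝕜) with hEs
  set Hs : PowerSeries 𝕜 := PowerSeries.mk fun k =>
    ((1 - q) ^ (1 - α) * (a * q ^ k) ^ (1 - α)) • f (a * q ^ k) with hHs
  set Gs : PowerSeries 𝕜 := PowerSeries.mk fun k =>
    ((1 - q) * (a * q ^ k)) • g (a * q ^ k) with hGs
  have h1 : (1 - PowerSeries.X) * Cs * Es = 1 := by
    have := congrArg (PowerSeries.map (algebraMap ℝ 𝕜)) (one_sub_X_mul_mk_dualCoeff hq₀ hq₁ α)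
    rw [map_mul, map_mul, map_sub, map_one, PowerSeries.map_X] at this
    exact this
  have h2 : Hs * Cs = PowerSeries.mk fun n => rightInt q a (1 - α) f (a * q ^ n) := by
    ext n
    rw [PowerSeries.coeff_mul, Finset.Nat.sum_antidiagonal_eq_sum_range_succ_mk,
      PowerSeries.coeff_mk, rightInt_grid hq₀ hq₁ ha hβ, Finset.smul_sum]
    refine Finset.sum_congr rfl fun k _ => ?_
    simp only [hHs, hCs, PowerSeries.coeff_mk, RCLike.real_smul_eq_coe_mul]
    push_cast
    ring
  -- Multiplying by 1 - X takes differences in n and so undoes the partial sums of g. Since Es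
  -- inverts (1 - X)Cs, this determines Hs.
  have h3 : (1 - PowerSeries.X) * (Hs * Cs) = PowerSeries.C U - Gs := by
    rw [h2]
    ext n
    cases n with
    | zero => simp [sub_mul, h, hGs]
    | succ n =>
      rw [sub_mul, one_mul, map_sub, PowerSeries.coeff_succ_X_mul, map_sub, PowerSeries.coeff_C,
        if_neg n.succ_ne_zero]
      simp only [PowerSeries.coeff_mk, h, hGs]
      rw [Finset.sum_range_succ _ (n + 1)]
      ring
  have h4 : Hs = PowerSeries.C U * Es - Gs * Es := by
    rw [← sub_mul, ← h3]
    linear_combination -Hs * h1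
  have h5 := congrArg (PowerSeries.coeff n) h4
  rw [map_sub, PowerSeries.coeff_C_mul, PowerSeries.coeff_mul,
    Finset.Nat.sum_antidiagonal_eq_sum_range_succ_mk] at h5
  simp only [hHs, hEs, hGs, PowerSeries.coeff_mk] at h5
  rw [h5, RCLike.real_smul_eq_coe_mul, mul_comm]
  congr 1
  refine Finset.sum_congr rfl fun k _ => ?_
  rw [RCLike.real_smul_eq_coe_mul (dualCoeff q α (n - k)), mul_comm]

theorem qPoch_grid (hq₀ : 0 < q) (hq₁ : q < 1) (ha : 0 < a) (hα₀ : 0 < α) (n : ℕ) :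
    a ^ (α - 1) * qPoch q (q * (a * q ^ n) / a) (α - 1) / qGamma q α =
      a ^ (α - 1) * (1 - q) ^ (α - 1) * qBinomCoeff q (q ^ α) n := by
  have hq : 0 < 1 - q := sub_pos.2 hq₁
  have h1 : q * (a * q ^ n) / a = q ^ (n + 1) := by
    rw [pow_succ']
    field_simp
  have hβ := (qPoch_self_pos hq₀ hq₁ hα₀).ne'
  rw [h1, qPoch_pow_succ hq₀ hq₁ hα₀, qGamma_eq hq₀, ← neg_sub α 1, Real.rpow_neg hq.le]
  have := (Real.rpow_pos_of_pos hq (α - 1)).ne'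
  field_simp

/-- The power q^((1-α)(n-k)) trades (aqᵏ)^(1-α) for (aqⁿ)^(1-α). This identifies the inverse
convolution as an integral of order α. -/
theorem rpow_mul_dualCoeff (hq₀ : 0 < q) (ha : 0 < a) (n k : ℕ) (hk : k ≤ n) :
    dualCoeff q α (n - k) * (a * q ^ k) =
      (a * q ^ n) ^ (1 - α) * (qBinomCoeff q (q ^ α) (n - k) * (a * q ^ k) ^ α) := by
  obtain ⟨m, rfl⟩ := Nat.exists_eq_add_of_le hk
  have hx : 0 < a * q ^ k := by positivity
  have h1 : (q ^ (1 - α)) ^ m = (q ^ m) ^ (1 - α) := Real.rpow_pow_comm hq₀.le _ _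
  have h2 : (a * q ^ (k + m)) ^ (1 - α) = (a * q ^ k) ^ (1 - α) * (q ^ m) ^ (1 - α) := by
    rw [pow_add, ← mul_assoc, Real.mul_rpow hx.le (by positivity)]
  have h3 : a * q ^ k = (a * q ^ k) ^ (1 - α) * (a * q ^ k) ^ α := by
    rw [← Real.rpow_add hx, sub_add_cancel, Real.rpow_one]
  rw [Nat.add_sub_cancel_left, dualCoeff, h1, h2]
  nth_rw 1 [h3]
  ring

/-- If `I^{1-α}_{q,a-} f = U - ∫_{qx}^a g` on the grid, then
`f = U a^(α-1) (q x/a; q)_{α-1} / Γ_q(α) - I^α_{q,a-} g` there. -/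
theorem eq_of_rightInt_eq (hq₀ : 0 < q) (hq₁ : q < 1) (ha : 0 < a) (hα₀ : 0 < α)
    (hα₁ : α < 1) {f g : ℝ → 𝕜} {U : 𝕜}
    (h : ∀ n : ℕ, rightInt q a (1 - α) f (a * q ^ n) =
      U - ∑ k ∈ Finset.range (n + 1), ((1 - q) * (a * q ^ k)) • g (a * q ^ k)) (n : ℕ) :
    f (a * q ^ n) =
      (a ^ (α - 1) * qPoch q (q * (a * q ^ n) / a) (α - 1) / qGamma q α) • U -
        rightInt q a α g (a * q ^ n) := by
  have hq : 0 < 1 - q := sub_pos.2 hq₁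
  have hx : 0 < a * q ^ n := by positivity
  have h0 : (1 - q) ^ (1 - α) * (a * q ^ n) ^ (1 - α) ≠ 0 := by positivity
  have hinv : (1 - q) ^ (1 - α) * (1 - q) ^ (α - 1) = 1 := by
    rw [← Real.rpow_add hq]; simp
  have hinv' : (1 - q) ^ (1 - α) * (1 - q) ^ α = 1 - q := by
    rw [← Real.rpow_add hq]; simp
  refine smul_right_injective 𝕜 h0 ?_
  simp only
  rw [rpow_smul_eq_of_rightInt_eq hq₀ hq₁ ha hα₁ h n, smul_sub, smul_smul, qPoch_grid hq₀ hq₁ ha hα₀,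
    rightInt_grid hq₀ hq₁ ha hα₀, smul_smul, Finset.smul_sum]
  congr 1
  · congr 1
    -- The U-term comes from the weight at the top grid point a, hence k = 0.
    have h1 := rpow_mul_dualCoeff (α := α) hq₀ ha n 0 n.zero_le
    rw [pow_zero, mul_one, Nat.sub_zero] at h1
    have h2 : a ^ (α - 1) * a = a ^ α := by
      rw [Real.rpow_sub_one ha.ne']
      field_simp
    refine mul_right_cancel₀ ha.ne' ?_
    rw [h1]
    linear_combination -(a * q ^ n) ^ (1 - α) * qBinomCoeff q (q ^ α) n * a ^ α * hinv -
      (1 - q) ^ (1 - α) * (1 - q) ^ (α - 1) * (a * q ^ n) ^ (1 - α) * qBinomCoeff q (q ^ α) n * h2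
  · refine Finset.sum_congr rfl fun k hk => ?_
    have h1 := rpow_mul_dualCoeff (α := α) hq₀ ha n k (Nat.lt_succ_iff.1 (Finset.mem_range.1 hk))
    rw [smul_smul, smul_smul]
    congr 1
    linear_combination (1 - q) * h1 - (a * q ^ n) ^ (1 - α) * (qBinomCoeff q (q ^ α) (n - k) *
      (a * q ^ k) ^ α) * hinv'

/-- The value at 0 has its own series, so the formula on the grid does not settle it. That series is
the sum of all coefficients of (U - G)E; with G and E absolutely summable the Cauchy product gives
(U - ∑G)·∑E, and ∑E cancels against Γ_q(1-α). -/
theorem rightInt_at_zero_of_eq (hq₀ : 0 < q) (hq₁ : q < 1) (ha : 0 < a) (hα₀ : 0 < α)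
    (hα₁ : α < 1) {f g : ℝ → 𝕜} {U : 𝕜}
    (h : ∀ n : ℕ, rightInt q a (1 - α) f (a * q ^ n) =
      U - ∑ k ∈ Finset.range (n + 1), ((1 - q) * (a * q ^ k)) • g (a * q ^ k))
    (hg : Summable fun k : ℕ => ‖((1 - q) * (a * q ^ k)) • g (a * q ^ k)‖) :
    rightInt q a (1 - α) f 0 = U - ∑' k : ℕ, ((1 - q) * (a * q ^ k)) • g (a * q ^ k) := by
  have hq : 0 < 1 - q := sub_pos.2 hq₁
  have hβ := qPoch_self_pos hq₀ hq₁ (sub_pos.2 hα₁)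
  have hκ := Real.rpow_pos_of_pos hq (1 - α)
  have he := summable_dualCoeff hq₀ hq₁ hα₀ hα₁
  have hE : HasSum (fun k => ((dualCoeff q α k : ℝ) : 𝕜)) ((qPoch q q (1 - α - 1) : ℝ) : 𝕜) := by
    have := RCLike.hasSum_ofReal (𝕜 := 𝕜) |>.2 he.hasSum
    rwa [tsum_dualCoeff hq₀ hq₁ hα₀ hα₁] at this
  have hEn : Summable fun k => ‖((dualCoeff q α k : ℝ) : 𝕜)‖ := by
    simpa only [RCLike.norm_ofReal] using he.abs
  set G := fun k : ℕ => ((1 - q) * (a * q ^ k)) • g (a * q ^ k) with hG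
  have hprod := hasSum_sum_range_mul_of_summable_norm hg hEn
  have hH : HasSum (fun n : ℕ => ((1 - q) ^ (1 - α)) • (a * q ^ n) ^ (1 - α) • f (a * q ^ n))
      (((qPoch q q (1 - α - 1) : ℝ) : 𝕜) * (U - ∑' k, G k)) := by
    have := (hE.mul_right U).sub hprod
    rw [hE.tsum_eq, mul_comm (∑' n, G n), ← mul_sub] at this
    convert! this using 1
    funext n
    rw [smul_smul, rpow_smul_eq_of_rightInt_eq hq₀ hq₁ ha hα₁ h n, RCLike.real_smul_eq_coe_mul]
    congr 1
    refine Finset.sum_congr rfl fun k _ => ?_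
    rw [RCLike.real_smul_eq_coe_mul (dualCoeff q α (n - k)), mul_comm]
  have hH' := hH.const_smul (((1 - q) ^ (1 - α))⁻¹)
  simp only [inv_smul_smul₀ hκ.ne'] at hH'
  rw [rightInt_at_zero hq₀ ha, tsum_conditional_eq hH'.summable, hH'.tsum_eq, smul_smul,
    ← RCLike.real_smul_eq_coe_mul, smul_smul]
  have : (1 - q) / qGamma q (1 - α) * ((1 - q) ^ (1 - α))⁻¹ * qPoch q q (1 - α - 1) = 1 := by
    rw [qGamma_eq hq₀, sub_sub_cancel, Real.rpow_sub hq, Real.rpow_one]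
    have := (Real.rpow_pos_of_pos hq α).ne'
    field_simp
  rw [this, one_smul]

end Right

end Inversion

/-! ### Estimates -/

section Estimates

variable {q a α : ℝ}

/-! ### Power bounds for the left-sided integral -/

section LeftBound

variable {E : Type*} [NormedAddCommGroup E] [NormedSpace ℝ E]

/-- Terms of the series `I^α_{q,0+} h` are summable if `h = O(x^μ)` for some `μ > -1`. -/
theorem summable_leftInt [CompleteSpace E] (hq₀ : 0 < q) (hq₁ : q < 1) (hα₀ : 0 < α) (hα₁ : α < 1) {μ : ℝ}
    (hμ : -1 < μ) {x C : ℝ} (hx : 0 < x) {h : ℝ → E}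
    (hh : ∀ k : ℕ, ‖h (x * q ^ k)‖ ≤ C * (x * q ^ k) ^ μ) :
    Summable (fun k : ℕ => (q ^ k * qBinomCoeff q (q ^ α) k) • h (x * q ^ k)) ∧
    ‖∑' k : ℕ, (q ^ k * qBinomCoeff q (q ^ α) k) • h (x * q ^ k)‖ ≤
      C * x ^ μ * (qPochInf q (q ^ (α + μ + 1)) / qPochInf q (q ^ (μ + 1))) := by
  obtain ⟨h1, h2⟩ := rpow_mem hq₀ hq₁ hα₀ hα₁
  have hμ' : 0 < μ + 1 := by linarith
  have hz₀ : 0 ≤ q ^ (μ + 1) := Real.rpow_nonneg hq₀.le _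
  have hz₁ : q ^ (μ + 1) < 1 := Real.rpow_lt_one hq₀.le hq₁ hμ'
  -- Applied to x^μ, the series is the q-binomial series at z = q^(μ+1), which is below 1 because μ
  -- > -1.
  have hs := (summable_qBinomCoeff_mul_pow hq₀ hq₁ h1 h2 hz₀ hz₁).hasSum.mul_left (C * x ^ μ)
  rw [tsum_qBinomCoeff hq₀ hq₁ h1 h2 hz₀ hz₁, ← Real.rpow_add hq₀, ← add_assoc] at hs
  have hb : ∀ k : ℕ, ‖(q ^ k * qBinomCoeff q (q ^ α) k) • h (x * q ^ k)‖ ≤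
      C * x ^ μ * (qBinomCoeff q (q ^ α) k * (q ^ (μ + 1)) ^ k) := fun k => by
    have hc := qBinomCoeff_pos hq₀ hq₁ h1 k
    have hqk := pow_pos hq₀ k
    have e : (q ^ (μ + 1)) ^ k = (q ^ k) ^ μ * q ^ k := by
      rw [Real.rpow_add hq₀, Real.rpow_one, mul_pow, Real.rpow_pow_comm hq₀.le]
    rw [norm_smul, Real.norm_of_nonneg (by positivity), e]
    refine (mul_le_mul_of_nonneg_left (hh k) (by positivity)).trans_eq ?_
    rw [Real.mul_rpow hx.le hqk.le]
    ring
  exact ⟨Summable.of_norm_bounded hs.summable hb, tsum_of_norm_bounded hs hb⟩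

theorem norm_leftInt_le [CompleteSpace E] (hq₀ : 0 < q) (hq₁ : q < 1) (hα₀ : 0 < α) (hα₁ : α < 1) {μ : ℝ}
    (hμ : -1 < μ) {x C : ℝ} (hx : 0 < x) {h : ℝ → E}
    (hh : ∀ k : ℕ, ‖h (x * q ^ k)‖ ≤ C * (x * q ^ k) ^ μ) :
    ‖leftInt q α h x‖ ≤ C * (x ^ (α + μ) * ((1 - q) ^ α *
      (qPochInf q (q ^ (α + μ + 1)) / qPochInf q (q ^ (μ + 1))))) := by
  have hq : 0 < 1 - q := sub_pos.2 hq₁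
  obtain ⟨h1, h2⟩ := summable_leftInt hq₀ hq₁ hα₀ hα₁ hμ hx hh
  rw [leftInt_grid hq₀ hq₁ hx hα₀, tsum_conditional_eq h1, norm_smul,
    Real.norm_of_nonneg (by positivity)]
  refine (mul_le_mul_of_nonneg_left h2 (by positivity)).trans_eq ?_
  rw [Real.rpow_add hx]
  ring

theorem leftInt_sub (hq₀ : 0 < q) (hq₁ : q < 1) (hα₀ : 0 < α) {x : ℝ} (hx : 0 < x)
    {f g h : ℝ → E} (hfgh : ∀ k : ℕ, f (x * q ^ k) = g (x * q ^ k) - h (x * q ^ k))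
    (hg : Summable (fun k : ℕ => (q ^ k * qBinomCoeff q (q ^ α) k) • g (x * q ^ k)))
    (hh : Summable (fun k : ℕ => (q ^ k * qBinomCoeff q (q ^ α) k) • h (x * q ^ k))) :
    leftInt q α f x = leftInt q α g x - leftInt q α h x := by
  have hs : (fun k : ℕ => (q ^ k * qBinomCoeff q (q ^ α) k) • f (x * q ^ k)) = fun k : ℕ =>
      (q ^ k * qBinomCoeff q (q ^ α) k) • g (x * q ^ k) -
        (q ^ k * qBinomCoeff q (q ^ α) k) • h (x * q ^ k) := by
    funext k
    rw [hfgh, smul_sub]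
  rw [leftInt_grid hq₀ hq₁ hx hα₀, leftInt_grid hq₀ hq₁ hx hα₀, leftInt_grid hq₀ hq₁ hx hα₀, hs,
    tsum_conditional_eq (hg.sub hh), tsum_conditional_eq hg, tsum_conditional_eq hh,
    hg.tsum_sub hh, smul_sub]

theorem leftInt_smul_const (hq₀ : 0 < q) (hq₁ : q < 1) (hα₀ : 0 < α) {x : ℝ} (hx : 0 < x)
    {f : ℝ → ℝ} (hf : Summable (fun k : ℕ => (q ^ k * qBinomCoeff q (q ^ α) k) • f (x * q ^ k)))
    (U : E) : leftInt q α (fun t => f t • U) x = leftInt q α f x • U := by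
  have hs := hf.hasSum.smul_const U
  simp only [smul_assoc] at hs
  rw [leftInt_grid hq₀ hq₁ hx hα₀, leftInt_grid hq₀ hq₁ hx hα₀, tsum_conditional_eq hf,
    tsum_conditional_eq hs.summable, hs.tsum_eq, smul_assoc]

end LeftBound

/-! ### Estimates in the q-integral L² norm -/

section L2

variable {E : Type*} [NormedAddCommGroup E]

theorem normL2_eq {f : ℝ → E} (hf : MemL2 q a f) :
    normL2 q a f = √(∑' k : ℕ, (1 - q) * (a * q ^ k) * ‖f (a * q ^ k)‖ ^ 2) := by
  have hf' : Summable fun k : ℕ => q ^ k • ‖f (a * q ^ k)‖ ^ 2 := by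
    simpa only [MemL2, smul_eq_mul] using hf
  rw [normL2, qInt, qIntZero, qIntZero, mul_zero, zero_smul, sub_zero, tsum_conditional_eq hf', smul_eq_mul, ← tsum_mul_left]
  congr 1
  refine tsum_congr fun k => ?_
  rw [smul_eq_mul]
  ring

theorem normL2_nonneg (f : ℝ → E) : 0 ≤ normL2 q a f := Real.sqrt_nonneg _

theorem sqrt_sum_le_normL2 (hq₀ : 0 < q) (hq₁ : q < 1) (ha : 0 < a) {f : ℝ → E}
    (hf : MemL2 q a f) (s : Finset ℕ) :
    √(∑ k ∈ s, (1 - q) * (a * q ^ k) * ‖f (a * q ^ k)‖ ^ 2) ≤ normL2 q a f := by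
  have hq : 0 < 1 - q := sub_pos.2 hq₁
  rw [normL2_eq hf]
  refine Real.sqrt_le_sqrt (Summable.sum_le_tsum s (fun k _ => by positivity) ?_)
  simpa only [mul_assoc] using (hf.mul_left a).mul_left (1 - q)

theorem memL2_mul {𝕜 : Type*} [RCLike 𝕜] (hq₀ : 0 < q) {f y : ℝ → 𝕜} (hf : MemL2 q a f) {M : ℝ}
    (hM : ∀ k : ℕ, ‖y (a * q ^ k)‖ ≤ M) : MemL2 q a fun x => f x * y x := by
  refine (hf.mul_right (M ^ 2)).of_nonneg_of_le (fun k => by positivity) fun k => ?_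
  rw [norm_mul, mul_pow, ← mul_assoc]
  have := pow_le_pow_left₀ (norm_nonneg _) (hM k) 2
  gcongr

theorem normL2_mul_le {𝕜 : Type*} [RCLike 𝕜] (hq₀ : 0 < q) (hq₁ : q < 1) (ha : 0 < a)
    {f y : ℝ → 𝕜} (hf : MemL2 q a f) {M : ℝ} (hM : ∀ k : ℕ, ‖y (a * q ^ k)‖ ≤ M) :
    normL2 q a (fun x => f x * y x) ≤ normL2 q a f * M := by
  have hq : 0 < 1 - q := sub_pos.2 hq₁
  have hM₀ : 0 ≤ M := (norm_nonneg _).trans (hM 0)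
  have hs : ∀ {g : ℝ → 𝕜}, MemL2 q a g →
      Summable fun k : ℕ => (1 - q) * (a * q ^ k) * ‖g (a * q ^ k)‖ ^ 2 := fun hg => by
    simpa only [mul_assoc] using (hg.mul_left a).mul_left (1 - q)
  rw [normL2_eq hf, normL2_eq (memL2_mul hq₀ hf hM), ← Real.sqrt_sq hM₀,
    ← Real.sqrt_mul' _ (by positivity), ← tsum_mul_right]
  refine Real.sqrt_le_sqrt ((hs (memL2_mul hq₀ hf hM)).tsum_le_tsum (fun k => ?_)
    ((hs hf).mul_right _))
  rw [norm_mul, mul_pow, ← mul_assoc]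
  have := pow_le_pow_left₀ (norm_nonneg _) (hM k) 2
  gcongr

theorem sum_pow_le_inv {ρ : ℝ} (h₀ : 0 ≤ ρ) (h₁ : ρ < 1) (n : ℕ) :
    ∑ k ∈ Finset.range n, ρ ^ k ≤ (1 - ρ)⁻¹ := by
  rw [← tsum_geometric_of_lt_one h₀ h₁]
  exact (summable_geometric_of_lt_one h₀ h₁).sum_le_tsum _ fun k _ => pow_nonneg h₀ k

theorem sum_mul_le_sqrt_weighted (s : Finset ℕ) {w : ℕ → ℝ} (b : ℕ → ℝ) (hw : ∀ k, 0 ≤ w k) :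
    ∑ k ∈ s, w k * b k ≤ √(∑ k ∈ s, w k) * √(∑ k ∈ s, w k * b k ^ 2) := by
  have := Real.sum_mul_le_sqrt_mul_sqrt s (fun k => √(w k)) fun k => √(w k) * b k
  simpa only [mul_pow, Real.sq_sqrt (hw _), ← mul_assoc, Real.mul_self_sqrt (hw _)] using this

/-- `‖f‖₁ ≤ √a ‖f‖₂` for the `q`-integral over `[0, a]`. -/
theorem summable_norm_and_tsum_le [NormedSpace ℝ E] (hq₀ : 0 < q) (hq₁ : q < 1) (ha : 0 < a)
    {g : ℝ → E} (hg : MemL2 q a g) :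
    Summable (fun k : ℕ => ‖((1 - q) * (a * q ^ k)) • g (a * q ^ k)‖) ∧
      ∑' k : ℕ, ‖((1 - q) * (a * q ^ k)) • g (a * q ^ k)‖ ≤ √a * normL2 q a g := by
  have hq : 0 < 1 - q := sub_pos.2 hq₁
  have hb : ∀ n, ∑ k ∈ Finset.range n, ‖((1 - q) * (a * q ^ k)) • g (a * q ^ k)‖ ≤
      √a * normL2 q a g := fun n => by
    have h1 := sum_mul_le_sqrt_weighted (Finset.range n) (w := fun k => (1 - q) * (a * q ^ k))
      (fun k => ‖g (a * q ^ k)‖) fun k => by positivity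
    have h3 : ∀ k : ℕ, ‖((1 - q) * (a * q ^ k)) • g (a * q ^ k)‖ =
        (1 - q) * (a * q ^ k) * ‖g (a * q ^ k)‖ := fun k => by
      rw [norm_smul, Real.norm_of_nonneg (by positivity)]
    simp only [h3]
    refine h1.trans (mul_le_mul (Real.sqrt_le_sqrt ?_) ?_ (Real.sqrt_nonneg _)
      (Real.sqrt_nonneg _))
    · have := mul_le_mul_of_nonneg_left (sum_pow_le_inv hq₀.le hq₁ n) (mul_pos hq ha).le
      rw [Finset.mul_sum] at this
      simp only [← mul_assoc]
      refine this.trans_eq ?_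
      field_simp
    · exact sqrt_sum_le_normL2 hq₀ hq₁ ha hg (Finset.range n)
  exact ⟨summable_of_sum_range_le (fun _ => norm_nonneg _) hb,
    Real.tsum_le_of_sum_range_le (fun _ => norm_nonneg _) hb⟩

/-- The coefficients are at most 1, and Cauchy–Schwarz is applied to x^α = x^(α-1/2)·x^(1/2). The
remaining sum is geometric with ratio q^(2α-1), which separates the cases α > 1/2 and α < 1/2. -/
theorem norm_rightInt_le [NormedSpace ℝ E] (hq₀ : 0 < q) (hq₁ : q < 1) (ha : 0 < a)
    (hα₀ : 0 < α) (hα₁ : α < 1) {g : ℝ → E} (hg : MemL2 q a g) (n : ℕ) :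
    ‖rightInt q a α g (a * q ^ n)‖ ≤ (1 - q) ^ (α - 1 / 2) *
      √(∑ k ∈ Finset.range (n + 1), (a * q ^ k) ^ (2 * α - 1)) * normL2 q a g := by
  have hq : 0 < 1 - q := sub_pos.2 hq₁
  obtain ⟨h1, h2⟩ := rpow_mem hq₀ hq₁ hα₀ hα₁
  have hx : ∀ k : ℕ, 0 < a * q ^ k := fun k => by positivity
  have hC : ∑ k ∈ Finset.range (n + 1), (a * q ^ k) ^ α * ‖g (a * q ^ k)‖ ≤
      √(∑ k ∈ Finset.range (n + 1), (a * q ^ k) ^ (2 * α - 1)) *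
        √(∑ k ∈ Finset.range (n + 1), (a * q ^ k) * ‖g (a * q ^ k)‖ ^ 2) := by
    have h := Real.sum_mul_le_sqrt_mul_sqrt (Finset.range (n + 1))
      (fun k => (a * q ^ k) ^ (α - 1 / 2)) (fun k => (a * q ^ k) ^ (1 / 2 : ℝ) * ‖g (a * q ^ k)‖)
    have e1 : ∀ k : ℕ, (a * q ^ k) ^ (α - 1 / 2) * (a * q ^ k) ^ (1 / 2 : ℝ) = (a * q ^ k) ^ α :=
      fun k => by rw [← Real.rpow_add (hx k), sub_add_cancel]
    have e2 : ∀ k : ℕ, (a * q ^ k) ^ (α - 1 / 2) * (a * q ^ k) ^ (α - 1 / 2) =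
        (a * q ^ k) ^ (2 * α - 1) := fun k => by
      rw [← Real.rpow_add (hx k)]
      ring_nf
    have e3 : ∀ k : ℕ, (a * q ^ k) ^ (1 / 2 : ℝ) * (a * q ^ k) ^ (1 / 2 : ℝ) = a * q ^ k :=
      fun k => by
      rw [← Real.rpow_add (hx k)]
      norm_num
    simp only [mul_pow _ ‖_‖, ← mul_assoc ((a * q ^ _) ^ (_ : ℝ)), sq ((a * q ^ _) ^ (_ : ℝ)),
      e1, e2, e3] at h
    exact h
  have hN : √(1 - q) * √(∑ k ∈ Finset.range (n + 1), (a * q ^ k) * ‖g (a * q ^ k)‖ ^ 2) ≤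
      normL2 q a g := by
    rw [← Real.sqrt_mul hq.le, Finset.mul_sum]
    simpa only [mul_assoc] using sqrt_sum_le_normL2 hq₀ hq₁ ha hg (Finset.range (n + 1))
  have h3 : ‖∑ k ∈ Finset.range (n + 1),
      (qBinomCoeff q (q ^ α) (n - k) * (a * q ^ k) ^ α) • g (a * q ^ k)‖ ≤
      ∑ k ∈ Finset.range (n + 1), (a * q ^ k) ^ α * ‖g (a * q ^ k)‖ := by
    refine norm_sum_le_of_le _ fun k _ => ?_
    have := Real.rpow_nonneg (hx k).le α
    rw [norm_smul, Real.norm_of_nonneg (mul_nonneg (qBinomCoeff_pos hq₀ hq₁ h1 _).le this)]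
    refine mul_le_mul_of_nonneg_right ?_ (norm_nonneg _)
    exact mul_le_of_le_one_left this (qBinomCoeff_le_one hq₀ hq₁ h1 h2 _)
  have h4 : (1 - q) ^ α = (1 - q) ^ (α - 1 / 2) * √(1 - q) := by
    rw [Real.sqrt_eq_rpow, ← Real.rpow_add hq, sub_add_cancel]
  rw [rightInt_grid hq₀ hq₁ ha hα₀, norm_smul, Real.norm_of_nonneg (by positivity)]
  refine (mul_le_mul_of_nonneg_left (h3.trans hC) (by positivity)).trans ?_
  rw [h4]
  calc _ = (1 - q) ^ (α - 1 / 2) * √(∑ k ∈ Finset.range (n + 1), (a * q ^ k) ^ (2 * α - 1)) *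
        (√(1 - q) * √(∑ k ∈ Finset.range (n + 1), (a * q ^ k) * ‖g (a * q ^ k)‖ ^ 2)) := by ring
    _ ≤ _ := mul_le_mul_of_nonneg_left hN (by positivity)

end L2

theorem one_sub_le_rpow (hq₀ : 0 < q) (hq₁ : q < 1) (hα₀ : 0 < α) : 1 - q ≤ (1 - q) ^ (1 - α) := by
  have hq : 0 < 1 - q := sub_pos.2 hq₁
  simpa using Real.rpow_le_rpow_of_exponent_ge hq (by linarith : 1 - q ≤ 1)
    (by linarith : 1 - α ≤ 1)

/-! ### The constants c_α and γ_α -/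

section Constants

theorem cConst_nonneg (hq₀ : 0 < q) (hq₁ : q < 1) (α : ℝ) : 0 ≤ cConst q α :=
  div_nonneg (Real.rpow_nonneg (sub_pos.2 hq₁).le _)
    (mul_nonneg (qPochInf_pos hq₀ hq₁ hq₁).le (Real.sqrt_nonneg _))

theorem qGamma_nonneg (hq₀ : 0 < q) (hq₁ : q < 1) {ν : ℝ} (hν : 0 < ν) : 0 ≤ qGamma q ν :=
  mul_nonneg (div_nonneg (qPochInf_pos hq₀ hq₁ hq₁).le
    (qPochInf_pos hq₀ hq₁ (Real.rpow_lt_one hq₀.le hq₁ hν)).le)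
    (Real.rpow_nonneg (sub_pos.2 hq₁).le _)

theorem gammaConst_nonneg (hq₀ : 0 < q) (hq₁ : q < 1) (hα₀ : 0 < α) : 0 ≤ gammaConst q α :=
  mul_nonneg (div_nonneg (qGamma_nonneg hq₀ hq₁ (by linarith))
    (mul_nonneg (qPochInf_pos hq₀ hq₁ (Real.rpow_lt_one hq₀.le hq₁ hα₀)).le
      (qGamma_nonneg hq₀ hq₁ (by linarith)))) (Real.sqrt_nonneg _)

variable {E : Type*} [NormedAddCommGroup E] [NormedSpace ℝ E]

/-- For `α > 1/2` the function `I^α_{q,a-} g` is bounded. -/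
theorem exists_rightInt_bound_cConst (hq₀ : 0 < q) (hq₁ : q < 1) (ha : 0 < a)
    (hα : 1 / 2 < α) (hα₁ : α < 1) {g : ℝ → E} (hg : MemL2 q a g) :
    ∃ μ C : ℝ, -1 < μ ∧ 0 < α + μ ∧ 0 ≤ C ∧
      (∀ n : ℕ, ‖rightInt q a α g (a * q ^ n)‖ ≤ C * (a * q ^ n) ^ μ) ∧
      C * (a ^ (α + μ) * ((1 - q) ^ α *
        (qPochInf q (q ^ (α + μ + 1)) / qPochInf q (q ^ (μ + 1))))) ≤
        a ^ (2 * α - 1 / 2) * cConst q α * normL2 q a g := by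
  have hq : 0 < 1 - q := sub_pos.2 hq₁
  have hs : 0 < 2 * α - 1 := by linarith
  have hρ := Real.rpow_lt_one hq₀.le hq₁ hs
  have hρ₀ := Real.rpow_pos_of_pos hq₀ (2 * α - 1)
  have hd : 0 < 1 - q ^ (2 * α - 1) := by linarith
  have hN := normL2_nonneg (q := q) (a := a) g
  -- For α > 1/2 the geometric series converges, so the bound is uniform in n and μ = 0.
  refine ⟨0, (1 - q) ^ (α - 1 / 2) * (a ^ (α - 1 / 2) / √(1 - q ^ (2 * α - 1))) * normL2 q a g,
    by norm_num, by linarith, by positivity, fun n => ?_, ?_⟩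
  · rw [Real.rpow_zero, mul_one]
    refine (norm_rightInt_le hq₀ hq₁ ha (by linarith) hα₁ hg n).trans ?_
    refine mul_le_mul_of_nonneg_right (mul_le_mul_of_nonneg_left ?_ (by positivity)) hN
    have h1 : ∀ k : ℕ, (a * q ^ k) ^ (2 * α - 1) = a ^ (2 * α - 1) * (q ^ (2 * α - 1)) ^ k :=
      fun k => by
      rw [Real.mul_rpow ha.le (by positivity), Real.rpow_pow_comm hq₀.le]
    have h2 : a ^ (α - 1 / 2) = √(a ^ (2 * α - 1)) := by
      rw [Real.sqrt_eq_rpow, ← Real.rpow_mul ha.le]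
      ring_nf
    rw [h2, ← Real.sqrt_div (by positivity)]
    refine Real.sqrt_le_sqrt ?_
    simp only [h1]
    rw [← Finset.mul_sum, div_eq_mul_inv]
    exact mul_le_mul_of_nonneg_left (sum_pow_le_inv hρ₀.le hρ _) (by positivity)
  · have h1 : a ^ (2 * α - 1 / 2) = a ^ (α - 1 / 2) * a ^ (α + 0) := by
      rw [← Real.rpow_add ha]
      ring_nf
    -- The factors (1-q)^α and (q^(α+1);q)_∞ are only bounded by 1; c_α does not contain them.
    have h2 : (1 - q) ^ α ≤ 1 := Real.rpow_le_one hq.le (by linarith) (by linarith)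
    have h3 : qPochInf q (q ^ (α + 0 + 1)) ≤ 1 := by
      have := qPochInf_le hq₀ hq₁ (Real.rpow_nonneg hq₀.le (α + 0 + 1))
        (Real.rpow_lt_one hq₀.le hq₁ (by linarith))
      have := Real.rpow_pos_of_pos hq₀ (α + 0 + 1)
      linarith
    have h4 := qPochInf_pos hq₀ hq₁ hq₁
    have h5 : (1 - q) ^ α * (qPochInf q (q ^ (α + 0 + 1)) / qPochInf q (q ^ (0 + 1 : ℝ))) ≤
        1 * (1 / qPochInf q q) := by
      rw [zero_add, Real.rpow_one]
      refine mul_le_mul h2 (div_le_div_of_nonneg_right h3 h4.le) ?_ zero_le_one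
      exact div_nonneg (qPochInf_pos hq₀ hq₁ (Real.rpow_lt_one hq₀.le hq₁ (by linarith))).le h4.le
    calc _ ≤ (1 - q) ^ (α - 1 / 2) * (a ^ (α - 1 / 2) / √(1 - q ^ (2 * α - 1))) * normL2 q a g *
          (a ^ (α + 0) * (1 * (1 / qPochInf q q))) := by gcongr
      _ = _ := by
        rw [h1, cConst]
        field_simp

/-- For `α < 1/2` the function `I^α_{q,a-} g` is `O(x^(α - 1/2))`. -/
theorem exists_rightInt_bound_gammaConst (hq₀ : 0 < q) (hq₁ : q < 1) (ha : 0 < a)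
    (hα : 1 / 4 < α) (hα₁ : α < 1 / 2) {g : ℝ → E} (hg : MemL2 q a g) :
    ∃ μ C : ℝ, -1 < μ ∧ 0 < α + μ ∧ 0 ≤ C ∧
      (∀ n : ℕ, ‖rightInt q a α g (a * q ^ n)‖ ≤ C * (a * q ^ n) ^ μ) ∧
      C * (a ^ (α + μ) * ((1 - q) ^ α *
        (qPochInf q (q ^ (α + μ + 1)) / qPochInf q (q ^ (μ + 1))))) ≤
        a ^ (2 * α - 1 / 2) * gammaConst q α * normL2 q a g := by
  have hq : 0 < 1 - q := sub_pos.2 hq₁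
  have hs : 0 < 1 - 2 * α := by linarith
  have hρ := Real.rpow_lt_one hq₀.le hq₁ hs
  have hρ₀ := Real.rpow_pos_of_pos hq₀ (1 - 2 * α)
  have hd : 0 < 1 - q ^ (1 - 2 * α) := by linarith
  have hN := normL2_nonneg (q := q) (a := a) g
  -- For α < 1/2 the terms grow with k and the last one dominates, giving order x^(α-1/2). Then α +
  -- μ = 2α - 1/2 is positive exactly when α > 1/4.
  refine ⟨α - 1 / 2, (1 - q) ^ (α - 1 / 2) * (1 / √(1 - q ^ (1 - 2 * α))) * normL2 q a g,
    by linarith, by linarith, by positivity, fun n => ?_, ?_⟩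
  · refine (norm_rightInt_le hq₀ hq₁ ha (by linarith) (by linarith) hg n).trans ?_
    rw [mul_right_comm, mul_right_comm (_ * _) (normL2 q a g)]
    rw [mul_right_comm, mul_assoc ((1 - q) ^ (α - 1 / 2)) _ ((a * q ^ n) ^ (α - 1 / 2))]
    refine mul_le_mul_of_nonneg_right (mul_le_mul_of_nonneg_left ?_ (by positivity)) hN
    have hx : 0 < a * q ^ n := by positivity
    -- Summed backwards from aqⁿ, the terms are geometric with ratio q^(1-2α) < 1.
    have h1 : ∀ k ∈ Finset.range (n + 1), (a * q ^ (n - k)) ^ (2 * α - 1) =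
        (a * q ^ n) ^ (2 * α - 1) * (q ^ (1 - 2 * α)) ^ k := fun k hk => by
      obtain ⟨m, rfl⟩ := Nat.exists_eq_add_of_le (Nat.lt_succ_iff.1 (Finset.mem_range.1 hk))
      have hxm : 0 < a * q ^ m := by positivity
      have h3 : a * q ^ (k + m) = a * q ^ m * q ^ k := by ring
      rw [Nat.add_sub_cancel_left, h3, Real.mul_rpow hxm.le (by positivity), mul_assoc,
        Real.rpow_pow_comm hq₀.le, ← Real.rpow_add (pow_pos hq₀ k)]
      ring_nf
      simp
    have h2 : (a * q ^ n) ^ (α - 1 / 2) = √((a * q ^ n) ^ (2 * α - 1)) := by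
      rw [Real.sqrt_eq_rpow, ← Real.rpow_mul hx.le]
      ring_nf
    rw [h2, one_div_mul_eq_div, ← Real.sqrt_div (by positivity)]
    refine Real.sqrt_le_sqrt ?_
    rw [← Finset.sum_range_reflect]
    simp only [Nat.add_sub_cancel]
    rw [Finset.sum_congr rfl h1, ← Finset.mul_sum, div_eq_mul_inv]
    exact mul_le_mul_of_nonneg_left (sum_pow_le_inv hρ₀.le hρ _) (by positivity)
  · have h1 : α + (α - 1 / 2) = 2 * α - 1 / 2 := by ring
    have h2 : 2 * α - 1 / 2 + 1 = 2 * α + 1 / 2 := by ring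
    have h3 : α - 1 / 2 + 1 = α + 1 / 2 := by ring
    have hP1 := qPochInf_pos hq₀ hq₁ (Real.rpow_lt_one hq₀.le hq₁ (by linarith : 0 < 2 * α + 1 / 2))
    have hP2 := qPochInf_pos hq₀ hq₁ (Real.rpow_lt_one hq₀.le hq₁ (by linarith : 0 < α + 1 / 2))
    have hPα : 0 < qPochInf q (q ^ α) :=
      qPochInf_pos hq₀ hq₁ (Real.rpow_lt_one hq₀.le hq₁ (by linarith))
    have hPq := qPochInf_pos hq₀ hq₁ hq₁
    have hP : qPochInf q (q ^ α) ≤ (1 - q) ^ (1 - α) := by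
      obtain ⟨h4, h5⟩ := rpow_mem hq₀ hq₁ (by linarith : 0 < α) (by linarith)
      have := qPochInf_le hq₀ hq₁ (Real.rpow_nonneg hq₀.le α) h4
      have := one_sub_le_rpow hq₀ hq₁ (by linarith : 0 < α)
      linarith
    -- γ_α is the constant obtained here times (1-q)^(1-α)/(q^α;q)_∞. That factor is at least 1, as
    -- (q^α;q)_∞ ≤ 1 - q^α ≤ 1 - q ≤ (1-q)^(1-α).
    have hγ : gammaConst q α = (1 - q) ^ (α - 1 / 2) * (1 / √(1 - q ^ (1 - 2 * α))) *
        ((1 - q) ^ α * (qPochInf q (q ^ (2 * α + 1 / 2)) / qPochInf q (q ^ (α + 1 / 2)))) *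
          ((1 - q) ^ (1 - α) / qPochInf q (q ^ α)) := by
      have e1 : √(1 - q) * (1 - q) ^ (1 - (α + 1 / 2)) = (1 - q) ^ (α - 1 / 2) * (1 - q) ^ α *
          (1 - q) ^ (1 - α) * (1 - q) ^ (1 - (2 * α + 1 / 2)) := by
        rw [Real.sqrt_eq_rpow, ← Real.rpow_add hq, ← Real.rpow_add hq, ← Real.rpow_add hq,
          ← Real.rpow_add hq]
        ring_nf
      have hp2 := Real.rpow_pos_of_pos hq (1 - (2 * α + 1 / 2))
      have hd' := Real.sqrt_pos.2 hd
      rw [gammaConst, qGamma, qGamma, Real.sqrt_div hq.le]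
      generalize (1 - q) ^ (1 - (2 * α + 1 / 2)) = t₁ at e1 hp2 ⊢
      generalize (1 - q) ^ (1 - (α + 1 / 2)) = t₂ at e1 ⊢
      generalize (1 - q) ^ (α - 1 / 2) = t₃ at e1 ⊢
      generalize (1 - q) ^ (1 - α) = t₄ at e1 ⊢
      generalize (1 - q) ^ α = t₅ at e1 ⊢
      generalize qPochInf q (q ^ (2 * α + 1 / 2)) = P₁ at hP1 ⊢
      generalize qPochInf q (q ^ (α + 1 / 2)) = P₂ at hP2 ⊢
      generalize √(1 - q ^ (1 - 2 * α)) = t₆ at hd' ⊢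
      field_simp
      linear_combination e1
    rw [h1, h2, h3, hγ]
    have : 1 ≤ (1 - q) ^ (1 - α) / qPochInf q (q ^ α) := (one_le_div hPα).2 hP
    set κ := (1 - q) ^ (α - 1 / 2) * (1 / √(1 - q ^ (1 - 2 * α))) with hκ
    set τ := (1 - q) ^ α * (qPochInf q (q ^ (2 * α + 1 / 2)) / qPochInf q (q ^ (α + 1 / 2))) with hτ
    have hnn : 0 ≤ κ * τ * a ^ (2 * α - 1 / 2) * normL2 q a g := by positivity
    calc _ = κ * τ * a ^ (2 * α - 1 / 2) * normL2 q a g * 1 := by ring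
      _ ≤ κ * τ * a ^ (2 * α - 1 / 2) * normL2 q a g * ((1 - q) ^ (1 - α) / qPochInf q (q ^ α)) :=
        mul_le_mul_of_nonneg_left this hnn
      _ = _ := by ring

end Constants

end Estimates

/-! ### The boundary value problem -/

section BoundaryValue

variable {q a α : ℝ}

theorem mem_grid (n : ℕ) : a * q ^ n ∈ grid q a := ⟨n, rfl⟩

theorem mem_gridZero (n : ℕ) : a * q ^ n ∈ gridZero q a := Or.inr ⟨n, rfl⟩

theorem grid_pos (hq₀ : 0 < q) (ha : 0 < a) (n : ℕ) : 0 < a * q ^ n := by positivity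

theorem grid_le (hq₀ : 0 < q) (hq₁ : q < 1) (ha : 0 < a) (n : ℕ) : a * q ^ n ≤ a :=
  mul_le_of_le_one_right ha.le (pow_le_one₀ hq₀.le hq₁.le)

theorem infAbs_le (p : ℝ → ℝ) (n : ℕ) : infAbs q a p ≤ |p (a * q ^ n)| :=
  ciInf_le ⟨0, by rintro _ ⟨x, rfl⟩; exact abs_nonneg _⟩ (⟨_, mem_grid n⟩ : grid q a)

theorem infAbs_pos {p : ℝ → ℝ} (hp : 0 < ⨅ x : grid q a, p x) : 0 < infAbs q a p := by
  have hb : BddBelow (range fun x : grid q a => p x) := by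
    by_contra h
    -- The infimum of a family unbounded below is 0 by convention, so a positive value already
    -- forces a lower bound.
    rw [Real.iInf_of_not_bddBelow h] at hp
    exact lt_irrefl _ hp
  have : Nonempty (grid q a) := ⟨⟨_, mem_grid 0⟩⟩
  exact hp.trans_le (le_ciInf fun x => (ciInf_le hb x).trans (le_abs_self _))

theorem abs_psi_integrand_le (hq₀ : 0 < q) (hq₁ : q < 1) (ha : 0 < a) (hα₀ : 0 < α)
    (hα₁ : α < 1) {p : ℝ → ℝ} {m : ℝ} (hm : 0 < m) (hp : ∀ n : ℕ, m ≤ |p (a * q ^ n)|) (n : ℕ) :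
    ‖a ^ (α - 1) * qPoch q (q * (a * q ^ n) / a) (α - 1) / (qGamma q α * p (a * q ^ n))‖ ≤
      a ^ (α - 1) * (1 - q) ^ (α - 1) / m := by
  have hq : 0 < 1 - q := sub_pos.2 hq₁
  obtain ⟨h1, h2⟩ := rpow_mem hq₀ hq₁ hα₀ hα₁
  have hd := (qBinomCoeff_pos hq₀ hq₁ h1 n).le
  rw [← div_div, qPoch_grid hq₀ hq₁ ha hα₀, norm_div, Real.norm_eq_abs (p _),
    Real.norm_of_nonneg (by positivity)]
  refine div_le_div₀ (by positivity) ?_ hm (hp n)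
  exact mul_le_of_le_one_right (by positivity) (qBinomCoeff_le_one hq₀ hq₁ h1 h2 n)

/-- Makes A(·) and B(·) bounded. Without this their suprema could be the default value 0 and control
nothing. -/
theorem exists_abs_psi_le (hq₀ : 0 < q) (hq₁ : q < 1) (ha : 0 < a) (hα₀ : 0 < α)
    (hα₁ : α < 1) {p : ℝ → ℝ} {m : ℝ} (hm : 0 < m) (hp : ∀ n : ℕ, m ≤ |p (a * q ^ n)|) :
    ∃ K, ∀ x ∈ gridZero q a, |psi q a α p x| ≤ K := by
  have hq : 0 < 1 - q := sub_pos.2 hq₁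
  have hP1 := qPochInf_pos hq₀ hq₁ (Real.rpow_lt_one hq₀.le hq₁ (by linarith : 0 < α + 0 + 1))
  have hP2 := qPochInf_pos hq₀ hq₁
    (Real.rpow_lt_one hq₀.le hq₁ (by linarith : (0 : ℝ) < 0 + 1))
  refine ⟨a ^ (α - 1) * (1 - q) ^ (α - 1) / m * (a ^ (α + 0) * ((1 - q) ^ α *
      (qPochInf q (q ^ (α + 0 + 1)) / qPochInf q (q ^ (0 + 1 : ℝ))))), ?_⟩
  rintro x (rfl | ⟨n, rfl⟩)
  · rw [psi, leftInt_at_zero, abs_zero]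
    positivity
  · refine (norm_leftInt_le (E := ℝ) (μ := 0) (C := a ^ (α - 1) * (1 - q) ^ (α - 1) / m) hq₀ hq₁ hα₀ hα₁ (by norm_num) (grid_pos hq₀ ha n)
      fun k => ?_).trans ?_
    · rw [Real.rpow_zero, mul_one, mul_assoc a, ← pow_add]
      exact abs_psi_integrand_le hq₀ hq₁ ha hα₀ hα₁ hm hp _
    · have := Real.rpow_le_rpow (grid_pos hq₀ ha n).le (grid_le hq₀ hq₁ ha n)
        (by linarith : 0 ≤ α + 0)
      gcongr

theorem norm_inv_smul_le {E : Type*} [NormedAddCommGroup E] [NormedSpace ℝ E] {m s C t : ℝ}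
    {v : E} (hm : 0 < m) (hs : m ≤ |s|) (hv : ‖v‖ ≤ C * t) : ‖s⁻¹ • v‖ ≤ C / m * t := by
  rw [norm_smul, norm_inv, Real.norm_eq_abs, inv_mul_eq_div, div_mul_eq_mul_div]
  exact div_le_div₀ ((norm_nonneg v).trans hv) hv hm hs

theorem le_supNorm {E : Type*} [NormedAddCommGroup E] {f : ℝ → E} {K : ℝ}
    (hf : ∀ x ∈ gridZero q a, ‖f x‖ ≤ K) {x : ℝ} (hx : x ∈ gridZero q a) :
    ‖f x‖ ≤ supNorm q a f :=
  le_ciSup (f := fun x : gridZero q a => ‖f x‖)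
    ⟨K, by rintro _ ⟨x, rfl⟩; exact hf x x.2⟩ ⟨x, hx⟩

section

variable {𝕜 : Type*} [RCLike 𝕜] {p r w : ℝ → ℝ} {c₁ c₂ d₁ d₂ : ℝ} {lam : 𝕜}

theorem memL2_sub (hq₀ : 0 < q) (hr : MemL2 q a r) (hw : MemL2 q a w) (lam : 𝕜) :
    MemL2 q a fun x => (r x : 𝕜) - lam * (w x : 𝕜) := by
  refine ((hr.mul_left 2).add (hw.mul_left (2 * ‖lam‖ ^ 2))).of_nonneg_of_le
    (fun n => by positivity) fun n => ?_
  have h1 := norm_sub_le ((r (a * q ^ n) : ℝ) : 𝕜) (lam * ((w (a * q ^ n) : ℝ) : 𝕜))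
  rw [norm_mul, RCLike.norm_ofReal, RCLike.norm_ofReal, ← Real.norm_eq_abs,
    ← Real.norm_eq_abs] at h1
  have h2 := pow_le_pow_left₀ (norm_nonneg _) h1 2
  have h3 := add_sq_le (a := ‖r (a * q ^ n)‖) (b := ‖lam‖ * ‖w (a * q ^ n)‖)
  have h4 := mul_le_mul_of_nonneg_left (h2.trans h3) (pow_pos hq₀ n).le
  linarith

/-- The equation at aqᵏ is a recursion from u(aqᵏ⁻¹) to u(aqᵏ). For k = 0 the preceding point is
a/q, where the free value enters. -/
theorem IsExtSolution.eq_sub_sum (hq₀ : 0 < q) (hq₁ : q < 1) (ha : 0 < a) {y u : ℝ → 𝕜}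
    (h : IsExtSolution q a α p r w c₁ c₂ d₁ d₂ lam y u) (n : ℕ) :
    u (a * q ^ n) = u (a / q) - ∑ k ∈ Finset.range (n + 1), ((1 - q) * (a * q ^ k)) •
      (((r (a * q ^ k) : 𝕜) - lam * (w (a * q ^ k) : 𝕜)) * y (a * q ^ k)) := by
  have hq : 0 < 1 - q := sub_pos.2 hq₁
  have hstep : ∀ k : ℕ, u (a * q ^ k) = u (q⁻¹ * (a * q ^ k)) - ((1 - q) * (a * q ^ k)) •
      (((r (a * q ^ k) : 𝕜) - lam * (w (a * q ^ k) : 𝕜)) * y (a * q ^ k)) := fun k => by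
    have hx := grid_pos hq₀ ha k
    have he := h.equation _ (mem_grid k)
    have hcoef : -1 / q * (a * q ^ k - q⁻¹ * (a * q ^ k))⁻¹ = ((1 - q) * (a * q ^ k))⁻¹ := by
      have : a * q ^ k - q⁻¹ * (a * q ^ k) = -((1 - q) * (a * q ^ k)) / q := by
        field_simp
        ring
      rw [this]
      field_simp
    have hne : (1 - q) * (a * q ^ k) ≠ 0 := by positivity
    rw [qDeriv, smul_smul, hcoef] at he
    have he' := congrArg (fun t => ((1 - q) * (a * q ^ k)) • t) he
    simp only [smul_sub, smul_add, smul_zero, smul_inv_smul₀ hne] at he'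
    simp only [RCLike.real_smul_eq_coe_mul] at he' ⊢
    linear_combination he'
  induction n with
  | zero =>
    have := hstep 0
    rw [this]
    simp [div_eq_inv_mul]
  | succ n ih =>
    have h1 : q⁻¹ * (a * q ^ (n + 1)) = a * q ^ n := by
      rw [pow_succ]
      field_simp
    rw [hstep (n + 1), h1, ih, Finset.sum_range_succ _ (n + 1)]
    ring

/-- Cramer's rule: the boundary conditions read c₁y₀ + c₂U = c₂G and d₁y₀ + (d₂ + d₁ψ(a))U = d₁Ta, a
system of determinant Δ. -/
theorem coef_eq_of_boundary (hΔ : Delta q a α p c₁ c₂ d₁ d₂ ≠ 0) {x : ℝ} {y₀ yn U G Ta Tn : 𝕜}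
    (hb₀ : c₁ • y₀ + c₂ • (U - G) = 0)
    (hb₁ : d₁ • (y₀ + psi q a α p a • U - Ta) + d₂ • U = 0)
    (hyn : yn = y₀ + psi q a α p x • U - Tn) :
    yn = coefA q a α p c₁ c₂ d₁ d₂ x • G + coefB q a α p c₁ c₂ d₁ d₂ x • Ta - Tn := by
  have hΔ' : ((Delta q a α p c₁ c₂ d₁ d₂ : ℝ) : 𝕜) ≠ 0 := RCLike.ofReal_ne_zero.2 hΔ
  refine mul_left_cancel₀ hΔ' ?_
  have hA : ((Delta q a α p c₁ c₂ d₁ d₂ : ℝ) : 𝕜) * ((coefA q a α p c₁ c₂ d₁ d₂ x : ℝ) : 𝕜)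
      = (c₂ * (d₂ + d₁ * (psi q a α p a - psi q a α p x)) : ℝ) := by
    rw [← RCLike.ofReal_mul, coefA, ← mul_assoc, mul_div_cancel₀ _ hΔ]
  have hB : ((Delta q a α p c₁ c₂ d₁ d₂ : ℝ) : 𝕜) * ((coefB q a α p c₁ c₂ d₁ d₂ x : ℝ) : 𝕜)
      = (d₁ * (c₁ * psi q a α p x - c₂) : ℝ) := by
    rw [← RCLike.ofReal_mul, coefB, ← mul_assoc, mul_div_cancel₀ _ hΔ]
  have hD : ((Delta q a α p c₁ c₂ d₁ d₂ : ℝ) : 𝕜) =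
      (c₁ * d₂ - c₂ * d₁ + c₁ * d₁ * psi q a α p a : ℝ) := rfl
  simp only [RCLike.real_smul_eq_coe_mul] at hb₀ hb₁ hyn ⊢
  rw [hyn]
  push_cast at hA hB hD
  linear_combination (d₂ + d₁ * (psi q a α p a : 𝕜)) * hb₀ - c₂ * hb₁ +
    (psi q a α p x : 𝕜) * (c₁ * hb₁ - d₁ * hb₀) - G * hA - Ta * hB +
    (y₀ + (psi q a α p x : 𝕜) * U) * hD

/-- I^α_{0+} is applied to the formula for the Caputo derivative. It may be split because both
pieces give summable series: the kernel over p is bounded, and `f` is O(x^μ) with μ > -1. -/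
theorem eq_add_psi_smul_sub (hq₀ : 0 < q) (hq₁ : q < 1) (ha : 0 < a) (hα₀ : 0 < α) (hα₁ : α < 1)
    {m : ℝ} (hm : 0 < m) (hp : ∀ n : ℕ, m ≤ |p (a * q ^ n)|) {y f : ℝ → 𝕜} {U : 𝕜} {n : ℕ}
    (hy : Tendsto (fun k : ℕ => y (a * q ^ n * q ^ k)) atTop (𝓝 (y 0))) {μ C : ℝ} (hμ : -1 < μ)
    (hf : ∀ k : ℕ, ‖f (a * q ^ k)‖ ≤ C * (a * q ^ k) ^ μ)
    (hcap : ∀ k : ℕ, leftCaputo q α y (a * q ^ k) =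
      (a ^ (α - 1) * qPoch q (q * (a * q ^ k) / a) (α - 1) / (qGamma q α * p (a * q ^ k))) • U -
        f (a * q ^ k)) :
    y (a * q ^ n) = y 0 + psi q a α p (a * q ^ n) • U - leftInt q α f (a * q ^ n) := by
  have hx := grid_pos hq₀ ha n
  have hxk : ∀ k : ℕ, a * q ^ n * q ^ k = a * q ^ (n + k) := fun k => by ring
  set φ : ℝ → ℝ := fun x => a ^ (α - 1) * qPoch q (q * x / a) (α - 1) / (qGamma q α * p x) with hφ
  have hs₁ := (summable_leftInt (μ := 0) (C := a ^ (α - 1) * (1 - q) ^ (α - 1) / m) (h := φ)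
    hq₀ hq₁ hα₀ hα₁ (by norm_num) hx fun k => by
      rw [Real.rpow_zero, mul_one, hxk]
      exact abs_psi_integrand_le hq₀ hq₁ ha hα₀ hα₁ hm hp _).1
  have hs₂ := (summable_leftInt (h := f) hq₀ hq₁ hα₀ hα₁ hμ hx fun k => by
      rw [hxk]
      exact hf _).1
  have hs₃ : Summable fun k : ℕ =>
      (q ^ k * qBinomCoeff q (q ^ α) k) • (φ (a * q ^ n * q ^ k) • U) := by
    simpa only [smul_assoc] using hs₁.smul_const U
  have h1 := leftInt_sub (f := leftCaputo q α y) (g := fun x => φ x • U) (h := f) hq₀ hq₁ hα₀ hx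
    (fun k => by rw [hxk]; exact hcap _) hs₃ hs₂
  rw [leftInt_leftCaputo hq₀ hq₁ hα₀ hα₁ hx hy, leftInt_smul_const hq₀ hq₁ hα₀ hx hs₁] at h1
  rw [psi]
  linear_combination h1

/-- An extended solution is represented by the Green operator of the problem. -/
theorem IsExtSolution.green (hq₀ : 0 < q) (hq₁ : q < 1) (ha : 0 < a) (hα₀ : 0 < α) (hα₁ : α < 1)
    {m : ℝ} (hm : 0 < m) (hp : ∀ n : ℕ, m ≤ |p (a * q ^ n)|)
    (hΔ : Delta q a α p c₁ c₂ d₁ d₂ ≠ 0) {y u g : ℝ → 𝕜}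
    (h : IsExtSolution q a α p r w c₁ c₂ d₁ d₂ lam y u)
    (hgdef : ∀ x, g x = ((r x : 𝕜) - lam * (w x : 𝕜)) * y x)
    (hg : Summable fun k : ℕ => ‖((1 - q) * (a * q ^ k)) • g (a * q ^ k)‖) {μ C : ℝ} (hμ : -1 < μ)
    (hC : ∀ n : ℕ, ‖rightInt q a α g (a * q ^ n)‖ ≤ C * (a * q ^ n) ^ μ) (n : ℕ) :
    y (a * q ^ n) = coefA q a α p c₁ c₂ d₁ d₂ (a * q ^ n) •
        ∑' k : ℕ, ((1 - q) * (a * q ^ k)) • g (a * q ^ k) +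
      coefB q a α p c₁ c₂ d₁ d₂ (a * q ^ n) •
        leftInt q α (fun t => (p t)⁻¹ • rightInt q a α g t) a -
      leftInt q α (fun t => (p t)⁻¹ • rightInt q a α g t) (a * q ^ n) := by
  have hu : ∀ n : ℕ, rightInt q a (1 - α) (fun t => p t • leftCaputo q α y t) (a * q ^ n) =
      u (a / q) - ∑ k ∈ Finset.range (n + 1), ((1 - q) * (a * q ^ k)) • g (a * q ^ k) := fun n => by
    simp only [hgdef]
    rw [← h.eq_sub_sum hq₀ hq₁ ha n, h.quasi _ (mem_gridZero n), quasiDeriv]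
  have hu₀ : u 0 = u (a / q) - ∑' k : ℕ, ((1 - q) * (a * q ^ k)) • g (a * q ^ k) := by
    rw [h.quasi 0 (Or.inl rfl), quasiDeriv, rightInt_at_zero_of_eq hq₀ hq₁ ha hα₀ hα₁ hu hg]
  have hpn : ∀ n : ℕ, p (a * q ^ n) ≠ 0 := fun n => abs_pos.1 (hm.trans_le (hp n))
  have hcap : ∀ n : ℕ, leftCaputo q α y (a * q ^ n) =
      (a ^ (α - 1) * qPoch q (q * (a * q ^ n) / a) (α - 1) / (qGamma q α * p (a * q ^ n))) •
        u (a / q) - (p (a * q ^ n))⁻¹ • rightInt q a α g (a * q ^ n) := fun n => by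
    have := eq_of_rightInt_eq hq₀ hq₁ ha hα₀ hα₁ hu n
    rw [← div_div, div_eq_inv_mul _ (p _), ← smul_smul, ← smul_sub, ← this, inv_smul_smul₀ (hpn n)]
  have hsplit : ∀ n : ℕ, y (a * q ^ n) = y 0 + psi q a α p (a * q ^ n) • u (a / q) -
      leftInt q α (fun t => (p t)⁻¹ • rightInt q a α g t) (a * q ^ n) := fun n =>
    eq_add_psi_smul_sub hq₀ hq₁ ha hα₀ hα₁ hm hp (h.regular _ (mem_gridZero n)) hμ
      (fun k => norm_inv_smul_le hm (hp k) (hC k)) hcap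
  have hb₀ := h.bc_zero
  have hb₁ := h.bc_right
  have hya := hsplit 0
  rw [pow_zero, mul_one] at hya
  have hyn := hsplit n
  rw [hu₀] at hb₀
  rw [hya] at hb₁
  exact coef_eq_of_boundary hΔ hb₀ hb₁ hyn

/-- If `‖r - λ w‖₂` is below the bound, then the only extended solution is zero. -/
theorem IsExtSolution.eqOn_zero (hq₀ : 0 < q) (hq₁ : q < 1) (ha : 0 < a) (hα₀ : 0 < α)
    (hα₁ : α < 1) (hp : 0 < ⨅ x : grid q a, p x) (hr : MemL2 q a r) (hw : MemL2 q a w)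
    (hΔ : Delta q a α p c₁ c₂ d₁ d₂ ≠ 0) {κ : ℝ} (hκ₀ : 0 ≤ κ)
    (hκ : ∀ g : ℝ → 𝕜, MemL2 q a g → ∃ μ C : ℝ, -1 < μ ∧ 0 < α + μ ∧ 0 ≤ C ∧
      (∀ n : ℕ, ‖rightInt q a α g (a * q ^ n)‖ ≤ C * (a * q ^ n) ^ μ) ∧
      C * (a ^ (α + μ) * ((1 - q) ^ α *
        (qPochInf q (q ^ (α + μ + 1)) / qPochInf q (q ^ (μ + 1))))) ≤
        a ^ (2 * α - 1 / 2) * κ * normL2 q a g)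
    (hlam : normL2 q a (fun x => (r x : 𝕜) - lam * (w x : 𝕜)) < bound q a α p c₁ c₂ d₁ d₂ κ)
    {y u : ℝ → 𝕜} (h : IsExtSolution q a α p r w c₁ c₂ d₁ d₂ lam y u) :
    EqOn y (fun _ => 0) (gridZero q a) := by
  have hq : 0 < 1 - q := sub_pos.2 hq₁
  have hm := infAbs_pos hp
  have hpm := infAbs_le (q := q) (a := a) p
  set m := infAbs q a p with hmdef
  set R : ℝ → 𝕜 := fun x => (r x : 𝕜) - lam * (w x : 𝕜) with hR
  have hRL := memL2_sub hq₀ hr hw lam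
  have hlim : Tendsto (fun n : ℕ => y (a * q ^ n)) atTop (𝓝 (y 0)) := by
    simpa using h.regular _ (mem_gridZero 0)
  -- The supremum leaves out x = 0, since the q-integrals do not see that point; y(0) is recovered
  -- at the end by regularity.
  set M := ⨆ n : ℕ, ‖y (a * q ^ n)‖ with hM
  have hyM : ∀ n : ℕ, ‖y (a * q ^ n)‖ ≤ M := fun n => le_ciSup hlim.norm.bddAbove_range n
  have hM₀ : 0 ≤ M := (norm_nonneg _).trans (hyM 0)
  have hgL := memL2_mul hq₀ hRL hyM
  have hgN := normL2_mul_le hq₀ hq₁ ha hRL hyM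
  obtain ⟨μ, C, hμ, hαμ, hC₀, hC, hCκ⟩ := hκ _ hgL
  obtain ⟨hgS, hG⟩ := summable_norm_and_tsum_le hq₀ hq₁ ha hgL
  have hgreen := h.green hq₀ hq₁ ha hα₀ hα₁ hm hpm hΔ (fun _ => rfl) hgS hμ hC
  obtain ⟨K, hK⟩ := exists_abs_psi_le hq₀ hq₁ ha hα₀ hα₁ hm hpm
  have haG : a ∈ gridZero q a := by simpa using mem_gridZero (q := q) (a := a) 0
  have hA : ∀ n : ℕ, ‖coefA q a α p c₁ c₂ d₁ d₂ (a * q ^ n)‖ ≤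
      supNorm q a (coefA q a α p c₁ c₂ d₁ d₂) := fun n =>
    le_supNorm (K := ‖c₂ / Delta q a α p c₁ c₂ d₁ d₂‖ * (‖d₂‖ + ‖d₁‖ * (K + K))) (fun x hx => by
      rw [coefA, norm_mul]
      gcongr
      refine (norm_add_le _ _).trans ?_
      rw [norm_mul]
      gcongr
      exact (norm_sub_le _ _).trans (add_le_add (hK _ haG) (hK _ hx))) (mem_gridZero n)
  have hB : ∀ n : ℕ, ‖coefB q a α p c₁ c₂ d₁ d₂ (a * q ^ n)‖ ≤
      supNorm q a (coefB q a α p c₁ c₂ d₁ d₂) := fun n =>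
    le_supNorm (K := ‖d₁ / Delta q a α p c₁ c₂ d₁ d₂‖ * (‖c₁‖ * K + ‖c₂‖)) (fun x hx => by
      rw [coefB, norm_mul]
      gcongr
      refine (norm_sub_le _ _).trans ?_
      rw [norm_mul]
      gcongr
      exact hK _ hx) (mem_gridZero n)
  have hT : ∀ n : ℕ, ‖leftInt q α (fun t => (p t)⁻¹ • rightInt q a α (fun x => R x * y x) t)
      (a * q ^ n)‖ ≤ a ^ (2 * α - 1 / 2) * κ * normL2 q a (fun x => R x * y x) / m := fun n => by
    have hP1 := qPochInf_pos hq₀ hq₁ (Real.rpow_lt_one hq₀.le hq₁ (by linarith : 0 < α + μ + 1))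
    have hP2 := qPochInf_pos hq₀ hq₁ (Real.rpow_lt_one hq₀.le hq₁ (by linarith : 0 < μ + 1))
    refine (norm_leftInt_le (C := C / m) hq₀ hq₁ hα₀ hα₁ hμ (grid_pos hq₀ ha n) fun k => ?_).trans ?_
    · rw [mul_assoc a, ← pow_add]
      exact norm_inv_smul_le hm (hpm _) (hC _)
    · rw [div_mul_eq_mul_div]
      refine div_le_div_of_nonneg_right (le_trans ?_ hCκ) hm.le
      have := Real.rpow_le_rpow (grid_pos hq₀ ha n).le (grid_le hq₀ hq₁ ha n) hαμ.le
      gcongr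
  have hN := normL2_nonneg (q := q) (a := a) R
  set N := normL2 q a R with hNdef
  set A := supNorm q a (coefA q a α p c₁ c₂ d₁ d₂) with hAdef
  set B := supNorm q a (coefB q a α p c₁ c₂ d₁ d₂) with hBdef
  have hA₀ : 0 ≤ A := (norm_nonneg _).trans (hA 0)
  have hB₀ : 0 ≤ B := (norm_nonneg _).trans (hB 0)
  have hD : N * ((1 + B) * a ^ (2 * α - 1 / 2) * κ + A * √a * m) < m := by
    -- The denominator of the bound may vanish, in which case division carries no information; the
    -- product is then 0 < m.
    have hD₀ : 0 ≤ (1 + B) * a ^ (2 * α - 1 / 2) * κ + A * √a * m := by positivity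
    rcases hD₀.eq_or_lt with h0 | h0
    · rw [← h0, mul_zero]
      exact hm
    · exact (lt_div_iff₀ h0).1 hlam
  have hT' : ∀ n : ℕ, ‖leftInt q α (fun t => (p t)⁻¹ • rightInt q a α (fun x => R x * y x) t)
      (a * q ^ n)‖ ≤ a ^ (2 * α - 1 / 2) * κ * (N * M) / m := fun n =>
    (hT n).trans (by gcongr)
  have hG' : ‖∑' k : ℕ, ((1 - q) * (a * q ^ k)) • (R (a * q ^ k) * y (a * q ^ k))‖ ≤
      √a * (N * M) := (norm_tsum_le_tsum_norm hgS).trans (hG.trans (by gcongr))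
  have hTa := hT' 0
  rw [pow_zero, mul_one] at hTa
  have hyn : ∀ n : ℕ, ‖y (a * q ^ n)‖ ≤
      N * ((1 + B) * a ^ (2 * α - 1 / 2) * κ + A * √a * m) / m * M := fun n => by
    rw [hgreen n]
    refine (norm_sub_le _ _).trans ((add_le_add ((norm_add_le _ _).trans (add_le_add
      ((norm_smul_le _ _).trans (mul_le_mul (hA n) hG' (norm_nonneg _) hA₀))
      ((norm_smul_le _ _).trans (mul_le_mul (hB n) hTa (norm_nonneg _) hB₀))))
      (hT' n)).trans_eq ?_)
    field_simp
    ring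
  -- M ≤ θM with θ < 1 and M ≥ 0.
  have hMz : M = 0 := by
    have h1 : M ≤ N * ((1 + B) * a ^ (2 * α - 1 / 2) * κ + A * √a * m) / m * M := ciSup_le hyn
    have h2 := (div_lt_one hm).2 hD
    nlinarith
  have hz : ∀ n : ℕ, y (a * q ^ n) = 0 := fun n => norm_le_zero_iff.1 ((hyM n).trans_eq hMz)
  rintro x (rfl | ⟨n, rfl⟩)
  · simp only [hz] at hlim
    exact (tendsto_nhds_unique tendsto_const_nhds hlim).symm
  · exact hz n

theorem isSolution_zero : IsSolution q a α p r w c₁ c₂ d₁ d₂ lam (fun _ => (0 : 𝕜)) := by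
  have h1 : leftCaputo q α (fun _ => (0 : 𝕜)) = fun _ => 0 := by
    funext x
    simp [leftCaputo, leftInt, qInt, qIntZero, qDeriv]
  have h2 : ∀ ν, rightInt q a ν (fun _ => (0 : 𝕜)) = fun _ => 0 := fun ν => by
    funext x
    simp [rightInt, qInt, qIntZero]
  have h3 : quasiDeriv q a α p (fun _ => (0 : 𝕜)) = fun _ => 0 := by
    rw [quasiDeriv, h1]
    simp [h2]
  refine ⟨fun _ _ => tendsto_const_nhds, fun x _ => ?_, ⟨0, ?_, ?_⟩, ?_, ?_⟩
  · rw [rightDeriv, h1]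
    simp [h2, qDeriv]
  · simp [h3]
  · simp
  · simp [h3]
  · simp [h3]

end

end BoundaryValue

end QFSL

end

/-! ### The theorem -/

theorem theorem3p8 {𝕜 : Type*} [RCLike 𝕜]
    (q a α : ℝ) (hq₀ : 0 < q) (hq₁ : q < 1) (ha : 0 < a)
    (p r w : ℝ → ℝ)
    (hp₀ : ∀ x ∈ QFSL.gridZero q a, p x ≠ 0)
    (hp : 0 < ⨅ x : QFSL.grid q a, p x)
    (hw₀ : ∀ x ∈ QFSL.gridZero q a, 0 < w x)
    (hr : QFSL.MemL2 q a r) (hw : QFSL.MemL2 q a w)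
    (c₁ c₂ d₁ d₂ : ℝ) (hc : c₁ ^ 2 + c₂ ^ 2 ≠ 0) (hd : d₁ ^ 2 + d₂ ^ 2 ≠ 0)
    (hΔ : QFSL.Delta q a α p c₁ c₂ d₁ d₂ ≠ 0)
    (lam : 𝕜)
    (hlam :
      (1 / 2 < α ∧ α < 1 ∧
        QFSL.normL2 q a (fun x => (r x : 𝕜) - lam * (w x : 𝕜)) <
          QFSL.bound q a α p c₁ c₂ d₁ d₂ (QFSL.cConst q α)) ∨
      (1 / 4 < α ∧ α < 1 / 2 ∧
        QFSL.normL2 q a (fun x => (r x : 𝕜) - lam * (w x : 𝕜)) <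
          QFSL.bound q a α p c₁ c₂ d₁ d₂ (QFSL.gammaConst q α))) :
    (∃ y : ℝ → 𝕜,
      QFSL.IsSolution q a α p r w c₁ c₂ d₁ d₂ lam y ∧
      ∀ z v : ℝ → 𝕜, QFSL.IsExtSolution q a α p r w c₁ c₂ d₁ d₂ lam z v →
        Set.EqOn z y (QFSL.gridZero q a)) ∧
    (QFSL.IsEigenvalue q a α p r w c₁ c₂ d₁ d₂ lam →
      QFSL.IsSimpleEigenvalue q a α p r w c₁ c₂ d₁ d₂ lam) := by
  have hα : 0 < α ∧ α < 1 := by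
    rcases hlam with ⟨h1, h2, _⟩ | ⟨h1, h2, _⟩ <;> constructor <;> linarith
  have hzero : ∀ z v : ℝ → 𝕜, QFSL.IsExtSolution q a α p r w c₁ c₂ d₁ d₂ lam z v →
      Set.EqOn z (fun _ => 0) (QFSL.gridZero q a) := by
    intro z v h
    rcases hlam with ⟨h1, h2, h3⟩ | ⟨h1, h2, h3⟩
    · exact h.eqOn_zero hq₀ hq₁ ha hα.1 hα.2 hp hr hw hΔ (QFSL.cConst_nonneg hq₀ hq₁ α)
        (fun g hg => QFSL.exists_rightInt_bound_cConst hq₀ hq₁ ha h1 h2 hg) h3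
    · exact h.eqOn_zero hq₀ hq₁ ha hα.1 hα.2 hp hr hw hΔ (QFSL.gammaConst_nonneg hq₀ hq₁ hα.1)
        (fun g hg => QFSL.exists_rightInt_bound_gammaConst hq₀ hq₁ ha h1 h2 hg) h3
  refine ⟨⟨fun _ => 0, QFSL.isSolution_zero, hzero⟩, ?_⟩
  rintro ⟨y, u, hyu, hne⟩
  -- Every solution vanishes on the grid and at 0, so c = 0 serves. The nonzero `y` in fact
  -- contradicts `hzero`: simplicity holds vacuously.
  refine ⟨y, u, hyu, hne, fun z v hz => ⟨0, fun x hx => ?_⟩⟩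
  simp [hzero z v hz hx]
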